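/- Let $J^k$ be the space of $k$-jets of functions $\psi:\mathbb R\to\mathbb R$, with coordinates $t,\psi_0,\psi_1,\dots,\psi_k$ (so $\psi_i$ is the $i$-th derivative of $\psi$), and let $K=\mathbb R(t,\psi_0,\psi_1,\psi_2,\dots)$ be the field of rational functions on the jet spaces. Let \[ D_t=\partial_t+\sum_{i\ge 0}\psi_{i+1}\,\partial_{\psi_i}\] be the total derivative. The group $G=\mathrm{SAff}_1(\mathbb R)\times \mathrm{PSL}_2(\mathbb R)\times\mathbb Z_2$ acts (locally) on smooth functions $\psi(t)$ with $\psi'(t)>0$, and by prolongation on their jets, through the compositions of the transformations \[ (t,\psi(t))\mapsto\left(e^{2s_2}t+s_1,\ \psi(e^{-2s_2}(t-s_1))\right),\quad (t,\psi(t))\mapsto\left(t,\ \frac{a\psi(t)+b}{c\psi(t)+d}\right)\ (ad-bc=1),\quad (t,\psi(t))\mapsto(-t,\,-\psi(-t)),\] where $s_1,s_2,a,b,c,d\in\mathbb R$; the second component is the new function at the variable $t$. A rational differential invariant is an element of $K$ that is constant on the $G$-orbits of jets, wherever it is defined. A derivation of $K$ is invariant if it commutes with the prolonged action of $G$ on rational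 functions. An element of $K$ has order $k$ if it is a rational function on $J^k$ but not on $J^{k-1}$. Put \[ I= \frac{(\psi_1^2 \psi_4-4 \psi_1 \psi_2 \psi_3+3 \psi_2^3)^2}{(2 \psi_1 \psi_3-3 \psi_2^2)^3}, \qquad J= \frac{\psi_1 (\psi_1^2 \psi_5-5 \psi_1 \psi_2 \psi_4+5 \psi_2^2 \psi_3)}{(2 \psi_1 \psi_3-3 \psi_2^2)^2}.\] Then $I$ has order $4$, $J$ has order $5$, $D_t(I)\neq 0$, the derivation $\hat\partial_I=D_t(I)^{-1}D_t$ is invariant, and the field of rational differential invariants is generated by $I$, $J$ and $\hat\partial_I$: the set of rational differential invariants is the smallest subfield of $K$ that contains $\mathbb R$, $I$ and $J$ and is closed under $\hat\partial_I$. The same holds if rationality is required only on the fibres of $J^k\to J^0$: for every nonempty open $U\subseteq J^0$, every family $(F_{t,\psi_0})_{(t,\psi_0)\in U}$ of rational functions in $\psi_1,\psi_2,\dots$ (with arbitrary dependence on $(t,\psi_0)$) that is constant on the $G$-orbits of jets over $U$, wherever it is defined, does not depend on $(t,\psi_0)$ and is an element of this field. -/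

import Mathlib

noncomputable section

namespace WeylJets

/-! ### Jets of functions `ψ(t)` and rational functions on jet spaces -/

/-- Polynomials in the coordinates `t, ψ₀, ψ₁, ψ₂, …` of the jet spaces of the trivial bundle
`ℝ × ℝ → ℝ`. The variable `none` is `t` and the variable `some i` is `ψ_i`. A polynomial involves
finitely many variables, hence lives on some finite jet space `J^k`. -/
abbrev JetPoly : Type := MvPolynomial (Option ℕ) ℝ

/-- The field of rational functions on the jet spaces `J^k`, `k` arbitrary. -/
abbrev JetRat : Type := FractionRing JetPoly

/-- The coordinate function `t`. -/
def tCoord : JetRat := algebraMap JetPoly JetRat (MvPolynomial.X none)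

/-- The coordinate function `ψ_i`. -/
def psi (i : ℕ) : JetRat := algebraMap JetPoly JetRat (MvPolynomial.X (some i))

/-- The coordinates of the jet of the function `ψ` at the point `t`. -/
def jet (ψ : ℝ → ℝ) (t : ℝ) : Option ℕ → ℝ
  | none => t
  | some i => iteratedDeriv i ψ t

/-- The rational function `f` is defined at the jet `x` and takes the value `y` there: it can be
written as `p / q` with polynomials `p, q` such that `q(x) ≠ 0` and `y = p(x) / q(x)`. -/
def HasValueAt (f : JetRat) (x : Option ℕ → ℝ) (y : ℝ) : Prop :=
  ∃ p q : JetPoly, MvPolynomial.eval x q ≠ 0 ∧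
    f * algebraMap JetPoly JetRat q = algebraMap JetPoly JetRat p ∧
    y = MvPolynomial.eval x p / MvPolynomial.eval x q

/-- The value of a rational function at a jet is unique. -/
theorem HasValueAt.unique {f : JetRat} {x : Option ℕ → ℝ} {y y' : ℝ}
    (h : HasValueAt f x y) (h' : HasValueAt f x y') : y = y' := by
  obtain ⟨p, q, hq, hf, rfl⟩ := h
  obtain ⟨p', q', hq', hf', rfl⟩ := h'
  have key : p * q' = p' * q := by
    apply IsFractionRing.injective JetPoly JetRat
    rw [map_mul, map_mul, ← hf, ← hf']
    ring
  have := congrArg (MvPolynomial.eval x) key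
  rw [map_mul, map_mul] at this
  field_simp
  linarith

/-- The rational functions on `J^k`. -/
def jetField (k : ℕ) : IntermediateField ℝ JetRat :=
  IntermediateField.adjoin ℝ (insert tCoord {f | ∃ i ≤ k, f = psi i})

/-- The rational function `f` has order exactly `k`: it is a function on `J^k`, but not on a lower
jet space. -/
def HasOrder (f : JetRat) (k : ℕ) : Prop :=
  f ∈ jetField k ∧ ∀ j < k, f ∉ jetField j

/-- The rational functions of the fibre coordinates `ψ₁, ψ₂, …` of the jet spaces over `J⁰`. -/
def fibreField : IntermediateField ℝ JetRat :=
  IntermediateField.adjoin ℝ {f | ∃ i ≥ 1, f = psi i}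

/-! ### The total derivative -/

/-- The total derivative `∂_t + ∑ ψ_{i+1} ∂_{ψ_i}` on polynomials. -/
def totalDPoly : Derivation ℝ JetPoly JetPoly :=
  MvPolynomial.mkDerivation ℝ fun v => match v with
    | none => 1
    | some i => MvPolynomial.X (some (i + 1))

/-- The total derivative on rational functions, by the quotient rule. -/
def totalDFun (f : JetRat) : JetRat :=
  let p := (IsLocalization.sec (nonZeroDivisors JetPoly) f).1
  let q : JetPoly := (IsLocalization.sec (nonZeroDivisors JetPoly) f).2
  (algebraMap JetPoly JetRat (totalDPoly p * q - p * totalDPoly q)) /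
    (algebraMap JetPoly JetRat q) ^ 2

/-- The quotient rule holds for every representation as a quotient. -/
theorem totalDFun_div (p q : JetPoly) (hq : q ≠ 0) :
    totalDFun (algebraMap JetPoly JetRat p / algebraMap JetPoly JetRat q) =
      (algebraMap JetPoly JetRat (totalDPoly p * q - p * totalDPoly q)) /
        (algebraMap JetPoly JetRat q) ^ 2 := by
  set f := algebraMap JetPoly JetRat p / algebraMap JetPoly JetRat q with hf
  have hs := IsLocalization.sec_spec (nonZeroDivisors JetPoly) f
  simp only [totalDFun]
  generalize (IsLocalization.sec (nonZeroDivisors JetPoly) f).1 = p₁ at hs ⊢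
  generalize (IsLocalization.sec (nonZeroDivisors JetPoly) f).2 = q₁ at hs ⊢
  obtain ⟨q₁, hq₁m⟩ := q₁
  have hq₁ : q₁ ≠ 0 := nonZeroDivisors.ne_zero hq₁m
  simp only at hs ⊢
  have inj := IsFractionRing.injective JetPoly JetRat
  have hQ : algebraMap JetPoly JetRat q ≠ 0 := by
    simpa using inj.ne hq
  have hQ₁ : algebraMap JetPoly JetRat q₁ ≠ 0 := by
    simpa using inj.ne hq₁
  have key : p * q₁ = p₁ * q := by
    apply inj
    rw [map_mul, map_mul, ← hs, hf]
    field_simp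
  have hD := congrArg totalDPoly key
  simp only [Derivation.leibniz, smul_eq_mul] at hD
  rw [div_eq_div_iff (pow_ne_zero 2 hQ₁) (pow_ne_zero 2 hQ), ← map_pow, ← map_pow, ← map_mul,
    ← map_mul]
  congr 1
  linear_combination (-q * q₁) * hD + (q * totalDPoly q₁ + q₁ * totalDPoly q) * key

theorem totalDFun_add (f g : JetRat) : totalDFun (f + g) = totalDFun f + totalDFun g := by
  obtain ⟨p, q, hq, rfl⟩ := IsFractionRing.div_surjective (A := JetPoly) f
  obtain ⟨r, s, hs, rfl⟩ := IsFractionRing.div_surjective (A := JetPoly) g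
  have hq := nonZeroDivisors.ne_zero hq
  have hs := nonZeroDivisors.ne_zero hs
  have inj := IsFractionRing.injective JetPoly JetRat
  have hQ : algebraMap JetPoly JetRat q ≠ 0 := by simpa using inj.ne hq
  have hS : algebraMap JetPoly JetRat s ≠ 0 := by simpa using inj.ne hs
  rw [div_add_div _ _ hQ hS, ← map_mul, ← map_mul, ← map_add, ← map_mul,
    totalDFun_div _ _ (mul_ne_zero hq hs), totalDFun_div _ _ hq, totalDFun_div _ _ hs]
  simp only [map_add, Derivation.leibniz, smul_eq_mul, map_mul, map_sub]
  field_simp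
  ring

theorem totalDFun_smul (c : ℝ) (f : JetRat) : totalDFun (c • f) = c • totalDFun f := by
  obtain ⟨p, q, hq, rfl⟩ := IsFractionRing.div_surjective (A := JetPoly) f
  have hq := nonZeroDivisors.ne_zero hq
  have hc : ∀ r : JetPoly, c • algebraMap JetPoly JetRat r = algebraMap JetPoly JetRat (c • r) :=
    fun r => by
      rw [Algebra.smul_def, Algebra.smul_def, map_mul, ← IsScalarTower.algebraMap_apply]
  rw [← smul_div_assoc, hc, totalDFun_div _ _ hq, totalDFun_div _ _ hq, ← smul_div_assoc, hc,
    Derivation.map_smul, smul_mul_assoc, smul_mul_assoc, smul_sub]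

theorem totalDFun_mul (f g : JetRat) :
    totalDFun (f * g) = f * totalDFun g + g * totalDFun f := by
  obtain ⟨p, q, hq, rfl⟩ := IsFractionRing.div_surjective (A := JetPoly) f
  obtain ⟨r, s, hs, rfl⟩ := IsFractionRing.div_surjective (A := JetPoly) g
  have hq := nonZeroDivisors.ne_zero hq
  have hs := nonZeroDivisors.ne_zero hs
  have inj := IsFractionRing.injective JetPoly JetRat
  have hQ : algebraMap JetPoly JetRat q ≠ 0 := by simpa using inj.ne hq
  have hS : algebraMap JetPoly JetRat s ≠ 0 := by simpa using inj.ne hs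
  rw [div_mul_div_comm, ← map_mul, ← map_mul,
    totalDFun_div _ _ (mul_ne_zero hq hs), totalDFun_div _ _ hq, totalDFun_div _ _ hs]
  simp only [Derivation.leibniz, smul_eq_mul, map_mul, map_sub, map_add]
  field_simp
  ring

/-- The total derivative `D_t = ∂_t + ∑ ψ_{i+1} ∂_{ψ_i}` on the field of rational functions. -/
def totalD : Derivation ℝ JetRat JetRat where
  toFun := totalDFun
  map_add' := totalDFun_add
  map_smul' := totalDFun_smul
  map_one_eq_zero' := by
    have h := totalDFun_mul 1 1
    simpa using h
  leibniz' := totalDFun_mul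

/-- On polynomials the total derivative is the given one; a derivation of the field with this
property is unique. -/
theorem totalD_algebraMap (p : JetPoly) :
    totalD (algebraMap JetPoly JetRat p) = algebraMap JetPoly JetRat (totalDPoly p) := by
  have h := totalDFun_div p 1 one_ne_zero
  simp only [map_one, div_one, one_pow, mul_one, Derivation.map_one_eq_zero, mul_zero,
    sub_zero] at h
  exact h

/-! ### The group action -/

/-- An element of `SAff₁(ℝ) × PSL₂(ℝ) × ℤ₂`. The orientation-preserving affine map is
`t ↦ e^{2 s₂} t + s₁`, the element of `PSL₂(ℝ)` is represented by the matrix `M = (a b; c d)` of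
determinant one (`M` and `-M` act in the same way), and `ε = -1` is the nontrivial element
of `ℤ₂`. -/
structure GroupElt where
  s₁ : ℝ
  s₂ : ℝ
  M : Matrix.SpecialLinearGroup (Fin 2) ℝ
  ε : ℤˣ

/-- The sign `ε` as a real number. -/
def GroupElt.sign (g : GroupElt) : ℝ := ((g.ε : ℤ) : ℝ)

/-- The action on the base, `t ↦ ε (e^{2 s₂} t + s₁)`. -/
def GroupElt.onBase (g : GroupElt) (t : ℝ) : ℝ := g.sign * (Real.exp (2 * g.s₂) * t + g.s₁)

/-- The denominator `c u + d` of the linear fractional transformation. -/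
def GroupElt.den (g : GroupElt) (u : ℝ) : ℝ := g.M 1 0 * u + g.M 1 1

/-- The action on functions: the composition of
`ψ ↦ (a ψ + b) / (c ψ + d)`, `ψ(t) ↦ ψ(e^{-2 s₂} (t - s₁))` and, if `ε = -1`,
`ψ(t) ↦ -ψ(-t)`. -/
def GroupElt.onFun (g : GroupElt) (ψ : ℝ → ℝ) (t : ℝ) : ℝ :=
  let τ := Real.exp (-(2 * g.s₂)) * (g.sign * t - g.s₁)
  g.sign * ((g.M 0 0 * ψ τ + g.M 0 1) / g.den (ψ τ))

/-- The germ at `t` of the function `ψ` lies in the domain of the (local) action of `g`: `ψ` is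
smooth with `ψ' > 0`, and the linear fractional transformation is defined at `ψ(t)`. -/
def GroupElt.Acts (g : GroupElt) (ψ : ℝ → ℝ) (t : ℝ) : Prop :=
  ContDiffAt ℝ (⊤ : ℕ∞) ψ t ∧ 0 < deriv ψ t ∧ g.den (ψ t) ≠ 0

/-! ### Differential invariants -/

/-- `f'` is the pull-back of `f` along the prolongation of `g` to the jet spaces: `f' (x) = f (g x)`
for all jets `x` such that both sides are defined. -/
def IsPullback (g : GroupElt) (f f' : JetRat) : Prop :=
  ∀ (ψ : ℝ → ℝ) (t : ℝ), g.Acts ψ t → ∀ y y' : ℝ,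
    HasValueAt f' (jet ψ t) y' → HasValueAt f (jet (g.onFun ψ) (g.onBase t)) y → y' = y

/-- The rational function `f` is a differential invariant: it is constant on the orbits. -/
def IsInvariant (f : JetRat) : Prop := ∀ g : GroupElt, IsPullback g f f

/-- The derivation `δ` is invariant: it commutes with the prolonged action of the group on rational
functions. -/
def IsInvariantDerivation (δ : Derivation ℝ JetRat JetRat) : Prop :=
  ∀ (g : GroupElt) (f f' : JetRat), IsPullback g f f' → IsPullback g (δ f) (δ f')

/-- A differential invariant over `U ⊆ J⁰` that is only rational on the fibres of the jet spaces
over `J⁰`. Here `F t u` is the rational function on the fibre over `(t, u)`, and no condition is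
imposed on the dependence on `(t, u)`. The function is constant on orbits, for all jets over `U`
at which it is defined. -/
def IsFibrewiseInvariantOn (U : Set (ℝ × ℝ)) (F : ℝ → ℝ → JetRat) : Prop :=
  (∀ t u, F t u ∈ fibreField) ∧
  ∀ (g : GroupElt) (ψ : ℝ → ℝ) (t : ℝ), g.Acts ψ t → (t, ψ t) ∈ U →
    (g.onBase t, g.onFun ψ (g.onBase t)) ∈ U → ∀ y y' : ℝ,
    HasValueAt (F t (ψ t)) (jet ψ t) y' →
    HasValueAt (F (g.onBase t) (g.onFun ψ (g.onBase t))) (jet (g.onFun ψ) (g.onBase t)) y → y' = y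

/-- The field generated by the set `S` and the derivation `δ`: the smallest field extension of `ℝ`
that contains `S` and is closed under `δ`. -/
def generatedField (S : Set JetRat) (δ : Derivation ℝ JetRat JetRat) :
    IntermediateField ℝ JetRat :=
  sInf {L | S ⊆ L ∧ ∀ f ∈ L, δ f ∈ L}

/-- The function `I`. -/
def invI : JetRat :=
  (psi 1 ^ 2 * psi 4 - 4 * psi 1 * psi 2 * psi 3 + 3 * psi 2 ^ 3) ^ 2 /
    (2 * psi 1 * psi 3 - 3 * psi 2 ^ 2) ^ 3

/-- The function `J`. -/
def invJ : JetRat :=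
  psi 1 * (psi 1 ^ 2 * psi 5 - 5 * psi 1 * psi 2 * psi 4 + 5 * psi 2 ^ 2 * psi 3) /
    (2 * psi 1 * psi 3 - 3 * psi 2 ^ 2) ^ 2

/-- The derivation `D_t(I)⁻¹ D_t`. -/
def derI : Derivation ℝ JetRat JetRat := (totalD invI)⁻¹ • totalD

end WeylJets

end

noncomputable section

namespace WeylJets

open Filter Topology

/-! ### Values of rational functions at jets -/

/-! The argument is a moving frame built on the Schwarzian derivative `S = schw 0`. Linear
fractional maps and the sign change of `ψ` do not affect `S`, and an affine change of `t` only
rescales it, so with `S_n = D_t^n S` a group element multiplies `S_n` by `r ^ (n + 2)`, where `r` is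
the inverse of its `rate` (`pullback_schw`). Weight-zero combinations are therefore invariant, among
them `I = S_1² / (8 S_0³)` and `J = S_2 / (4 S_0²) + 1`. The quotient `m = S_1 / S_0` has weight
one, hence the functions `normSchw n = S_n / m ^ (n + 2)` are invariant too; a recursion in `n` puts
all of them into the field generated by `I`, `J` and `derI` (`normSchw_mem`).

Conversely, the coordinates `ψ_i` are polynomials in `ψ₀, ψ₁, ψ₁⁻¹, ψ₂` and the `S_j`
(`exists_aeval_schwGens`). A generic jet can be moved by the group so that `t, ψ₀, ψ₁, ψ₂` and `m`
take prescribed values (`exists_groupElt`). The remaining coordinates of the moved jet are then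
polynomials in the `normSchw j` of the original jet, so evaluating `f = p / q` at the moved jet
gives an element of the generated field (`exists_mem_generatedField`). An invariant `f` takes the
same value at both jets, hence equals that element. In the fibrewise case all points of `U` are
moved to one base point, so a single element serves for all of them.

The pointwise notion of invariance is made algebraic by `isPullback_iff`: the prolonged action is a
field endomorphism `pullback g`, and identities of rational functions can be tested at generic jets.
-/

theorem algebraMap_ne_zero {p : JetPoly} (hp : p ≠ 0) : algebraMap JetPoly JetRat p ≠ 0 := by
  simpa using (IsFractionRing.injective JetPoly JetRat).ne hp

theorem algebraMap_real_eq (c : ℝ) :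
    algebraMap ℝ JetRat c = algebraMap JetPoly JetRat (MvPolynomial.C c) := by
  rw [IsScalarTower.algebraMap_apply ℝ JetPoly JetRat]; rfl

namespace HasValueAt

variable {f f' : JetRat} {x : Option ℕ → ℝ} {y y' : ℝ}

theorem polynomial (p : JetPoly) (x : Option ℕ → ℝ) :
    HasValueAt (algebraMap JetPoly JetRat p) x (MvPolynomial.eval x p) :=
  ⟨p, 1, by simp, by simp, by simp⟩

theorem const (c : ℝ) (x : Option ℕ → ℝ) : HasValueAt (algebraMap ℝ JetRat c) x c := by
  simpa [algebraMap_real_eq] using HasValueAt.polynomial (MvPolynomial.C c) x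

theorem psi (i : ℕ) (x : Option ℕ → ℝ) : HasValueAt (psi i) x (x (some i)) := by
  simpa [WeylJets.psi] using HasValueAt.polynomial (MvPolynomial.X (some i)) x

theorem tCoord (x : Option ℕ → ℝ) : HasValueAt tCoord x (x none) := by
  simpa [WeylJets.tCoord] using HasValueAt.polynomial (MvPolynomial.X none) x

theorem add (h : HasValueAt f x y) (h' : HasValueAt f' x y') : HasValueAt (f + f') x (y + y') := by
  obtain ⟨p, q, hq, hf, rfl⟩ := h
  obtain ⟨p', q', hq', hf', rfl⟩ := h'
  refine ⟨p * q' + p' * q, q * q', by simp [hq, hq'], ?_, ?_⟩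
  · simp only [map_add, map_mul, ← hf, ← hf']; ring
  · simp only [map_add, map_mul]; field_simp

theorem mul (h : HasValueAt f x y) (h' : HasValueAt f' x y') : HasValueAt (f * f') x (y * y') := by
  obtain ⟨p, q, hq, hf, rfl⟩ := h
  obtain ⟨p', q', hq', hf', rfl⟩ := h'
  refine ⟨p * p', q * q', by simp [hq, hq'], ?_, ?_⟩
  · simp only [map_mul, ← hf, ← hf']; ring
  · simp only [map_mul]; field_simp

theorem neg (h : HasValueAt f x y) : HasValueAt (-f) x (-y) := by
  simpa using (const (-1) x).mul h

theorem sub (h : HasValueAt f x y) (h' : HasValueAt f' x y') : HasValueAt (f - f') x (y - y') := by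
  simpa [sub_eq_add_neg] using h.add h'.neg

theorem pow (h : HasValueAt f x y) (n : ℕ) : HasValueAt (f ^ n) x (y ^ n) := by
  induction n with
  | zero => simpa using const 1 x
  | succ n ih => simpa [pow_succ] using ih.mul h

theorem ne_zero (h : HasValueAt f x y) (hy : y ≠ 0) : f ≠ 0 := by
  rintro rfl
  exact hy (h.unique (by simpa using const 0 x))

theorem inv (h : HasValueAt f x y) (hy : y ≠ 0) : HasValueAt f⁻¹ x y⁻¹ := by
  have hf0 := h.ne_zero hy
  obtain ⟨p, q, hq, hf, rfl⟩ := h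
  have hp : MvPolynomial.eval x p ≠ 0 := fun h0 => hy (by simp [h0])
  refine ⟨q, p, hp, ?_, by rw [inv_div]⟩
  rw [← hf]; field_simp

theorem div (h : HasValueAt f x y) (h' : HasValueAt f' x y') (hy : y' ≠ 0) :
    HasValueAt (f / f') x (y / y') := by
  simpa [div_eq_mul_inv] using h.mul (h'.inv hy)

theorem of_eq (h : HasValueAt f x y) (hf : f' = f) (hy : y' = y) : HasValueAt f' x y' := by
  rwa [hf, hy]

theorem aeval {σ : Type*} {θ : σ → JetRat} {v : σ → ℝ} (h : ∀ i, HasValueAt (θ i) x (v i))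
    (p : MvPolynomial σ ℝ) : HasValueAt (MvPolynomial.aeval θ p) x (MvPolynomial.eval v p) := by
  induction p using MvPolynomial.induction_on with
  | C c => simpa using const c x
  | add p q hp hq => simpa using hp.add hq
  | mul_X p i hp => simpa using hp.mul (h i)

end HasValueAt

/-! ### The total derivative along the jet of a function -/

/-- By the Leibniz rule it suffices to treat the coordinates. The neighbourhood depends on `p`:
smoothness at `t` yields `C^n` near `t` only for one finite `n` at a time. -/
theorem eventually_hasDerivAt_eval_jet {ψ : ℝ → ℝ} {t : ℝ} (hψ : ContDiffAt ℝ (⊤ : ℕ∞) ψ t)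
    (p : JetPoly) :
    ∀ᶠ s in 𝓝 t, HasDerivAt (fun s => MvPolynomial.eval (jet ψ s) p)
      (MvPolynomial.eval (jet ψ s) (totalDPoly p)) s := by
  induction p using MvPolynomial.induction_on with
  | C c =>
    refine Eventually.of_forall fun s => ?_
    simpa [totalDPoly] using hasDerivAt_const s c
  | add p q hp hq =>
    filter_upwards [hp, hq] with s hp hq
    simpa [Pi.add_def] using hp.add hq
  | mul_X p i hp =>
    have hi : ∀ᶠ s in 𝓝 t, HasDerivAt (fun s => jet ψ s i)
        (MvPolynomial.eval (jet ψ s) (totalDPoly (MvPolynomial.X i))) s := by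
      rcases i with _ | i
      · refine Eventually.of_forall fun s => ?_
        simpa [totalDPoly, jet] using hasDerivAt_id' s
      · simp only [totalDPoly, MvPolynomial.mkDerivation_X, MvPolynomial.eval_X, jet]
        have h1 : ContDiffAt ℝ ((i + 1 : ℕ) : ℕ∞) ψ t :=
          hψ.of_le (by exact_mod_cast le_top)
        filter_upwards [h1.eventually (by simp)] with s hs
        rw [iteratedDeriv_succ]
        refine DifferentiableAt.hasDerivAt ?_
        have := (contDiffWithinAt_univ.2 hs).differentiableWithinAt_iteratedDerivWithin (m := i)
          (by exact_mod_cast Nat.lt_succ_self i) (by simp)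
        rwa [iteratedDerivWithin_univ, differentiableWithinAt_univ] at this
    filter_upwards [hp, hi] with s hp hi
    have := hp.mul hi
    simp only [map_mul, MvPolynomial.eval_X, Derivation.leibniz, smul_eq_mul, map_add]
    exact this.congr_deriv (by ring)

/-- A rational function defined at a jet of `ψ` is defined along the jet of `ψ`, and its total
derivative is the derivative along the jet. -/
theorem HasValueAt.exists_hasDerivAt {f : JetRat} {ψ : ℝ → ℝ} {t y : ℝ}
    (hψ : ContDiffAt ℝ (⊤ : ℕ∞) ψ t) (h : HasValueAt f (jet ψ t) y) :
    ∃ φ φ' : ℝ → ℝ, ∀ᶠ s in 𝓝 t, HasValueAt f (jet ψ s) (φ s) ∧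
      HasDerivAt φ (φ' s) s ∧ HasValueAt (totalD f) (jet ψ s) (φ' s) := by
  obtain ⟨p, q, hq, hf, rfl⟩ := h
  have hp' := eventually_hasDerivAt_eval_jet hψ p
  have hq' := eventually_hasDerivAt_eval_jet hψ q
  have hq0 : q ≠ 0 := by rintro rfl; simp at hq
  have hfq : f = algebraMap JetPoly JetRat p / algebraMap JetPoly JetRat q := by
    rw [← hf, mul_div_cancel_right₀ _ (algebraMap_ne_zero hq0)]
  refine ⟨fun s => MvPolynomial.eval (jet ψ s) p / MvPolynomial.eval (jet ψ s) q,
    fun s => (MvPolynomial.eval (jet ψ s) (totalDPoly p) * MvPolynomial.eval (jet ψ s) q -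
      MvPolynomial.eval (jet ψ s) p * MvPolynomial.eval (jet ψ s) (totalDPoly q)) /
      MvPolynomial.eval (jet ψ s) q ^ 2, ?_⟩
  filter_upwards [hp', hq', hq'.self_of_nhds.continuousAt.eventually_ne hq] with s hps hqs hs
  refine ⟨⟨p, q, hs, hf, rfl⟩, hps.div hqs hs, totalDPoly p * q - p * totalDPoly q, q ^ 2,
    by simpa using hs, ?_, by simp⟩
  rw [hfq]
  change totalDFun _ * _ = _
  rw [totalDFun_div _ _ hq0, map_pow, div_mul_cancel₀ _ (pow_ne_zero 2 (algebraMap_ne_zero hq0))]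

theorem HasValueAt.exists_totalD {f : JetRat} {ψ : ℝ → ℝ} {t y : ℝ}
    (hψ : ContDiffAt ℝ (⊤ : ℕ∞) ψ t) (h : HasValueAt f (jet ψ t) y) :
    ∃ y', HasValueAt (totalD f) (jet ψ t) y' := by
  obtain ⟨φ, φ', h⟩ := h.exists_hasDerivAt hψ
  exact ⟨_, h.self_of_nhds.2.2⟩

/-! ### Generic jets -/

theorem iteratedDeriv_polynomial (q : Polynomial ℝ) (n : ℕ) :
    iteratedDeriv n (fun s => q.eval s) = fun s => (Polynomial.derivative^[n] q).eval s := by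
  induction n with
  | zero => simp
  | succ n ih =>
    rw [iteratedDeriv_succ, ih, Function.iterate_succ_apply']
    funext s
    exact Polynomial.deriv _

/-- Every finite jet is the jet of a polynomial. -/
theorem exists_jet_eq {x : Option ℕ → ℝ} {N : ℕ} (hx : ∀ i, N < i → x (some i) = 0) :
    ∃ ψ : ℝ → ℝ, ContDiff ℝ (⊤ : ℕ∞) ψ ∧ jet ψ (x none) = x := by
  set p : Polynomial ℝ :=
    ∑ i ∈ Finset.range (N + 1), Polynomial.monomial i (x (some i) / i.factorial) with hp
  have hc : ∀ n, p.coeff n = x (some n) / n.factorial := by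
    intro n
    simp only [hp, Polynomial.finsetSum_coeff, Polynomial.coeff_monomial, Finset.sum_ite_eq',
      Finset.mem_range]
    split_ifs with h
    · rfl
    · rw [hx n (by omega), zero_div]
  -- This is `p(s - x none)`, whose Taylor coefficients at `x none` are the coefficients of `p`.
  set q := Polynomial.taylor (-x none) p with hq
  have hpq : Polynomial.taylor (x none) q = p := by
    rw [hq, Polynomial.taylor_taylor]; simp
  refine ⟨fun s => q.eval s, by simpa using q.contDiff_aeval (𝕜 := ℝ) _, ?_⟩
  funext v
  rcases v with _ | n
  · rfl
  · simp only [jet, iteratedDeriv_polynomial]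
    rw [← Polynomial.factorial_smul_hasseDeriv]
    have h := hc n
    rw [← hpq, Polynomial.taylor_coeff] at h
    have h' : ((n.factorial • Polynomial.hasseDeriv n) q).eval (x none) =
        n.factorial * (Polynomial.hasseDeriv n q).eval (x none) := by simp
    rw [h', h]
    field_simp

theorem exists_jet_eval_ne_zero {r : JetPoly} {x : Option ℕ → ℝ} (hx : 0 < x (some 1))
    (hr : MvPolynomial.eval x r ≠ 0) :
    ∃ ψ : ℝ → ℝ, ContDiff ℝ (⊤ : ℕ∞) ψ ∧ ψ (x none) = x (some 0) ∧ 0 < deriv ψ (x none) ∧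
      MvPolynomial.eval (jet ψ (x none)) r ≠ 0 := by
  obtain ⟨N, hN⟩ : ∃ N : ℕ, ∀ i, some i ∈ r.vars → i ≤ N := by
    refine ⟨r.vars.sup fun v => v.getD 0, fun i hi => ?_⟩
    exact Finset.le_sup (f := fun v : Option ℕ => v.getD 0) hi
  -- Truncation leaves the variables of `r` untouched; the cut at `N + 1` rather than `N` also keeps
  -- the positive value of `ψ₁` when `N = 0`.
  set x' : Option ℕ → ℝ := fun v => match v with
    | none => x none
    | some i => if i ≤ N + 1 then x (some i) else 0 with hx'
  obtain ⟨ψ, hψ, hj⟩ := exists_jet_eq (x := x') (N := N + 1)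
    (fun i hi => by simp [hx', not_le.2 hi])
  have h0 : x' none = x none := rfl
  rw [h0] at hj
  refine ⟨ψ, hψ, ?_, ?_, ?_⟩
  · have := congrFun hj (some 0)
    simpa [jet, hx'] using this
  · have := congrFun hj (some 1)
    simp only [jet, iteratedDeriv_one, hx'] at this
    rw [this]
    simpa using hx
  · rw [hj]
    convert hr using 1
    refine MvPolynomial.eval₂Hom_congr' rfl (fun i hi _ => ?_) rfl
    rcases i with _ | i
    · rfl
    · simp [hx', show i ≤ N + 1 by have := hN i hi; omega]

theorem exists_eval_ne_zero {r : JetPoly} (hr : r ≠ 0) :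
    ∃ x : Option ℕ → ℝ, 0 < x (some 1) ∧ MvPolynomial.eval x r ≠ 0 := by
  by_contra! h
  refine hr (MvPolynomial.funext_set (fun _ => Set.Ioi (0 : ℝ)) (fun _ => Set.Ioi_infinite 0) ?_)
  intro x hx
  simpa using h x (hx (some 1) trivial)

/-- The coordinates of the fibres of the jet spaces over `J⁰`. -/
def fibreVars : Set (Option ℕ) := {v | ∃ i ≥ 1, v = some i}

/-- `f` is a quotient of polynomials in the variables in `s`. -/
def IsFracIn (s : Set (Option ℕ)) (f : JetRat) : Prop :=
  ∃ p ∈ MvPolynomial.supported ℝ s, ∃ q ∈ MvPolynomial.supported ℝ s, q ≠ 0 ∧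
    f * algebraMap JetPoly JetRat q = algebraMap JetPoly JetRat p

theorem isFracIn_univ (f : JetRat) : IsFracIn Set.univ f := by
  obtain ⟨p, q, hq, rfl⟩ := IsFractionRing.div_surjective (A := JetPoly) f
  have hq := nonZeroDivisors.ne_zero hq
  exact ⟨p, by simp, q, by simp, hq, div_mul_cancel₀ _ (algebraMap_ne_zero hq)⟩

/-- A numerator and a denominator free of `t` and `ψ₀` allow these two coordinates to be prescribed
without losing regularity. -/
theorem isFracIn_fibreVars {f : JetRat} (hf : f ∈ fibreField) : IsFracIn fibreVars f := by
  have key : ∀ r ∈ Algebra.adjoin ℝ {f | ∃ i ≥ 1, f = psi i},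
      ∃ p ∈ MvPolynomial.supported ℝ fibreVars, algebraMap JetPoly JetRat p = r := by
    intro r hr
    induction hr using Algebra.adjoin_induction with
    | mem r hr =>
      obtain ⟨i, hi, rfl⟩ := hr
      exact ⟨_, MvPolynomial.X_mem_supported.2 ⟨i, hi, rfl⟩, rfl⟩
    | algebraMap c =>
      exact ⟨algebraMap ℝ JetPoly c, Subalgebra.algebraMap_mem _ c,
        (IsScalarTower.algebraMap_apply ℝ JetPoly JetRat c).symm⟩
    | add a b _ _ ha hb =>
      obtain ⟨p, hp, rfl⟩ := ha
      obtain ⟨q, hq, rfl⟩ := hb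
      exact ⟨p + q, add_mem hp hq, map_add _ _ _⟩
    | mul a b _ _ ha hb =>
      obtain ⟨p, hp, rfl⟩ := ha
      obtain ⟨q, hq, rfl⟩ := hb
      exact ⟨p * q, mul_mem hp hq, map_mul _ _ _⟩
  obtain ⟨a, ha, b, hb, rfl⟩ := IntermediateField.mem_adjoin_iff_div.1 hf
  obtain ⟨p, hp, rfl⟩ := key a ha
  obtain ⟨q, hq, rfl⟩ := key b hb
  -- The quotient may have denominator zero, and is then `0` by convention.
  by_cases h0 : q = 0
  · exact ⟨0, zero_mem _, 1, one_mem _, one_ne_zero, by simp [h0]⟩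
  · exact ⟨p, hp, q, hq, h0, div_mul_cancel₀ _ (algebraMap_ne_zero h0)⟩

/-- `f` is defined at `x`, and does not vanish there unless it is zero. -/
def IsRegularAt (f : JetRat) (x : Option ℕ → ℝ) : Prop :=
  ∃ y, HasValueAt f x y ∧ (f ≠ 0 → y ≠ 0)

theorem exists_poly_isRegularAt {s : Set (Option ℕ)} (l : List JetRat)
    (hl : ∀ f ∈ l, IsFracIn s f) :
    ∃ r ∈ MvPolynomial.supported ℝ s, r ≠ 0 ∧
      ∀ x, MvPolynomial.eval x r ≠ 0 → ∀ f ∈ l, IsRegularAt f x := by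
  induction l with
  | nil => exact ⟨1, one_mem _, one_ne_zero, by simp⟩
  | cons f l ih =>
    obtain ⟨r, hrs, hr, h⟩ := ih fun g hg => hl g (List.mem_cons_of_mem _ hg)
    obtain ⟨p, hp, q, hq, hq0, hpq⟩ := hl f List.mem_cons_self
    by_cases hf : f = 0
    · refine ⟨r, hrs, hr, fun x hx g hg => ?_⟩
      rcases List.mem_cons.1 hg with rfl | hg
      · exact ⟨0, by simpa [hf] using HasValueAt.const 0 x, fun h => absurd hf h⟩
      · exact h x hx g hg
    · have hp0 : p ≠ 0 := by
        rintro rfl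
        rw [map_zero] at hpq
        exact mul_ne_zero hf (algebraMap_ne_zero hq0) hpq
      refine ⟨r * (p * q), mul_mem hrs (mul_mem hp hq), mul_ne_zero hr (mul_ne_zero hp0 hq0),
        fun x hx g hg => ?_⟩
      simp only [map_mul, mul_ne_zero_iff] at hx
      rcases List.mem_cons.1 hg with rfl | hg
      · exact ⟨_, ⟨p, q, hx.2.2, hpq, rfl⟩, fun _ => div_ne_zero hx.2.1 hx.2.2⟩
      · exact h x hx.1 g hg

/-- Finitely many rational functions are regular at a common jet. -/
theorem exists_jet_isRegularAt (l : List JetRat) :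
    ∃ (ψ : ℝ → ℝ) (t : ℝ), ContDiff ℝ (⊤ : ℕ∞) ψ ∧ 0 < deriv ψ t ∧
      ∀ f ∈ l, IsRegularAt f (jet ψ t) := by
  obtain ⟨r, -, hr, h⟩ := exists_poly_isRegularAt l fun f _ => isFracIn_univ f
  obtain ⟨x, hx, hxr⟩ := exists_eval_ne_zero hr
  obtain ⟨ψ, hψ, -, h1, h2⟩ := exists_jet_eval_ne_zero hx hxr
  exact ⟨ψ, _, hψ, h1, h _ h2⟩

/-- Finitely many rational functions of the fibre coordinates are regular at a common jet over a
prescribed point of `J⁰`. -/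
theorem exists_jet_isRegularAt_of_mem_fibreField (l : List JetRat) (hl : ∀ f ∈ l, f ∈ fibreField)
    (t u : ℝ) :
    ∃ ψ : ℝ → ℝ, ContDiff ℝ (⊤ : ℕ∞) ψ ∧ ψ t = u ∧ 0 < deriv ψ t ∧
      ∀ f ∈ l, IsRegularAt f (jet ψ t) := by
  obtain ⟨r, hrs, hr, h⟩ := exists_poly_isRegularAt l fun f hf => isFracIn_fibreVars (hl f hf)
  obtain ⟨x, hx, hxr⟩ := exists_eval_ne_zero hr
  set x' : Option ℕ → ℝ := fun v => match v with
    | none => t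
    | some 0 => u
    | some (i + 1) => x (some (i + 1)) with hx'
  have hxr' : MvPolynomial.eval x' r ≠ 0 := by
    convert hxr using 1
    refine MvPolynomial.eval₂Hom_congr' rfl (fun i hi _ => ?_) rfl
    obtain ⟨j, hj, rfl⟩ := MvPolynomial.mem_supported.1 hrs hi
    obtain ⟨k, rfl⟩ := Nat.exists_eq_add_of_le' hj
    rfl
  obtain ⟨ψ, hψ, h0, h1, h2⟩ := exists_jet_eval_ne_zero (x := x') hx hxr'
  exact ⟨ψ, hψ, h0, h1, h _ h2⟩

/-! ### The prolonged action on rational functions -/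

namespace GroupElt

theorem sign_mul_sign (g : GroupElt) : g.sign * g.sign = 1 := by
  rcases Int.units_eq_one_or g.ε with h | h <;> simp [sign, h]

theorem sign_ne_zero (g : GroupElt) : g.sign ≠ 0 := fun h => by simpa [h] using g.sign_mul_sign

theorem det_eq (g : GroupElt) : g.M 0 0 * g.M 1 1 - g.M 0 1 * g.M 1 0 = 1 := by
  have := g.M.det_coe
  rwa [Matrix.det_fin_two] at this

/-- The derivative of the action on the base. -/
def rate (g : GroupElt) : ℝ := g.sign * Real.exp (2 * g.s₂)

theorem rate_ne_zero (g : GroupElt) : g.rate ≠ 0 := mul_ne_zero g.sign_ne_zero (Real.exp_ne_zero _)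

/-- The inverse group element. -/
def inverse (g : GroupElt) : GroupElt where
  s₁ := -(g.sign * Real.exp (-(2 * g.s₂)) * g.s₁)
  s₂ := -g.s₂
  -- The inverse matrix conjugated by `diag(ε, 1)`, because the sign acts after the linear
  -- fractional map.
  M := ⟨!![g.M 1 1, -(g.sign * g.M 0 1); -(g.sign * g.M 1 0), g.M 0 0], by
    rw [Matrix.det_fin_two_of]
    linear_combination g.det_eq - (g.M 0 1 * g.M 1 0) * g.sign_mul_sign⟩
  ε := g.ε

theorem sign_inverse (g : GroupElt) : g.inverse.sign = g.sign := rfl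

theorem inverse_onBase (g : GroupElt) (t : ℝ) :
    g.inverse.onBase t = Real.exp (-(2 * g.s₂)) * (g.sign * t - g.s₁) := by
  simp only [onBase, sign_inverse]
  simp only [inverse, mul_neg]
  linear_combination (-Real.exp (-(2 * g.s₂)) * g.s₁) * g.sign_mul_sign

theorem exp_mul_exp_neg (g : GroupElt) : Real.exp (2 * g.s₂) * Real.exp (-(2 * g.s₂)) = 1 := by
  rw [← Real.exp_add]; simp

theorem inverse_onBase_onBase (g : GroupElt) (t : ℝ) : g.inverse.onBase (g.onBase t) = t := by
  rw [inverse_onBase, onBase]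
  linear_combination (Real.exp (-(2 * g.s₂)) * (Real.exp (2 * g.s₂) * t + g.s₁)) * g.sign_mul_sign +
    t * g.exp_mul_exp_neg

theorem onBase_inverse_onBase (g : GroupElt) (t : ℝ) : g.onBase (g.inverse.onBase t) = t := by
  rw [inverse_onBase, onBase]
  linear_combination t * g.sign_mul_sign + (g.sign * (g.sign * t - g.s₁)) * g.exp_mul_exp_neg

theorem onFun_eq (g : GroupElt) (ψ : ℝ → ℝ) (r : ℝ) :
    g.onFun ψ r = g.sign * ((g.M 0 0 * ψ (g.inverse.onBase r) + g.M 0 1) /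
      g.den (ψ (g.inverse.onBase r))) := by
  rw [inverse_onBase]; rfl

theorem hasDerivAt_inverse_onBase (g : GroupElt) (r : ℝ) :
    HasDerivAt g.inverse.onBase g.rate⁻¹ r := by
  have h : HasDerivAt (fun t => Real.exp (-(2 * g.s₂)) * (g.sign * t - g.s₁))
      (Real.exp (-(2 * g.s₂)) * (g.sign * 1)) r :=
    (((hasDerivAt_id' r).const_mul _).sub_const _).const_mul _
  rw [show g.inverse.onBase = fun t => Real.exp (-(2 * g.s₂)) * (g.sign * t - g.s₁) from
    funext g.inverse_onBase]
  refine h.congr_deriv (eq_inv_of_mul_eq_one_left ?_)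
  rw [rate]
  linear_combination (Real.exp (2 * g.s₂) * Real.exp (-(2 * g.s₂))) * g.sign_mul_sign +
    g.exp_mul_exp_neg

/-- The denominator `c ψ₀ + d` as a rational function. -/
def denRat (g : GroupElt) : JetRat :=
  algebraMap ℝ JetRat (g.M 1 0) * psi 0 + algebraMap ℝ JetRat (g.M 1 1)

theorem hasValueAt_denRat (g : GroupElt) (x : Option ℕ → ℝ) :
    HasValueAt g.denRat x (g.den (x (some 0))) :=
  ((HasValueAt.const _ x).mul (HasValueAt.psi 0 x)).add (HasValueAt.const _ x)

theorem denRat_ne_zero (g : GroupElt) : g.denRat ≠ 0 := by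
  by_cases h : g.M 1 1 = 0
  · refine (g.hasValueAt_denRat fun _ => 1).ne_zero ?_
    have := g.det_eq
    simp only [den, h, mul_one, add_zero]
    rintro h'
    simp [h, h'] at this
  · refine (g.hasValueAt_denRat fun _ => 0).ne_zero ?_
    simpa [den] using h

/-- The coordinates of the transformed jet as functions on the jet spaces. -/
def pullbackCoord (g : GroupElt) : Option ℕ → JetRat
  | none => algebraMap ℝ JetRat g.sign *
      (algebraMap ℝ JetRat (Real.exp (2 * g.s₂)) * tCoord + algebraMap ℝ JetRat g.s₁)
  | some i => (fun f => algebraMap ℝ JetRat g.rate⁻¹ * totalD f)^[i] (algebraMap ℝ JetRat g.sign *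
      ((algebraMap ℝ JetRat (g.M 0 0) * psi 0 + algebraMap ℝ JetRat (g.M 0 1)) / g.denRat))

theorem hasValueAt_pullbackCoord (g : GroupElt) {ψ : ℝ → ℝ} {t : ℝ}
    (hψ : ContDiffAt ℝ (⊤ : ℕ∞) ψ t) (hd : g.den (ψ t) ≠ 0) (v : Option ℕ) :
    HasValueAt (g.pullbackCoord v) (jet ψ t) (jet (g.onFun ψ) (g.onBase t) v) := by
  rcases v with _ | i
  · exact (HasValueAt.const _ _).mul
      (((HasValueAt.const _ _).mul (HasValueAt.tCoord _)).add (HasValueAt.const _ _))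
  -- The induction needs a neighbourhood: the next derivative depends on the values at nearby jets.
  suffices h : ∀ᶠ s in 𝓝 t, HasValueAt (g.pullbackCoord (some i)) (jet ψ s)
      (iteratedDeriv i (g.onFun ψ) (g.onBase s)) from h.self_of_nhds
  induction i with
  | zero =>
    have hc : ContinuousAt (fun s => g.den (ψ s)) t := by
      have := hψ.continuousAt
      unfold den
      fun_prop
    filter_upwards [hc.eventually_ne hd] with s hs
    have h0 := HasValueAt.psi 0 (jet ψ s)
    have h0' : jet ψ s (some 0) = ψ s := by simp [jet]
    refine ((HasValueAt.const g.sign (jet ψ s)).mul ((((HasValueAt.const _ _).mul h0).add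
      (HasValueAt.const _ _)).div (g.hasValueAt_denRat _) ?_)).of_eq rfl ?_
    · rwa [h0']
    · rw [iteratedDeriv_zero, onFun_eq, inverse_onBase_onBase, h0']
  | succ i ih =>
    obtain ⟨φ, φ', h⟩ := ih.self_of_nhds.exists_hasDerivAt hψ
    filter_upwards [h, ih.eventually_nhds, h.eventually_nhds] with s hs h1 h2
    have h3 : ∀ᶠ s in 𝓝 s, iteratedDeriv i (g.onFun ψ) (g.onBase s) = φ s := by
      filter_upwards [h1, h2] with s h1 h2
      exact h1.unique h2.1
    have h4 : iteratedDeriv i (g.onFun ψ) =ᶠ[𝓝 (g.onBase s)] φ ∘ g.inverse.onBase := by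
      have hc : Tendsto g.inverse.onBase (𝓝 (g.onBase s)) (𝓝 s) := by
        have := (g.hasDerivAt_inverse_onBase (g.onBase s)).continuousAt.tendsto
        rwa [inverse_onBase_onBase] at this
      filter_upwards [hc.eventually h3] with r hr
      rw [Function.comp_apply, ← hr, onBase_inverse_onBase]
    have h5 : HasDerivAt φ (φ' s) (g.inverse.onBase (g.onBase s)) := by
      rw [inverse_onBase_onBase]; exact hs.2.1
    have h6 := (h5.comp _ (g.hasDerivAt_inverse_onBase _)).congr_of_eventuallyEq h4
    rw [iteratedDeriv_succ, h6.deriv]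
    refine ((HasValueAt.const g.rate⁻¹ _).mul hs.2.2).of_eq ?_ (mul_comm _ _)
    simp only [pullbackCoord, Function.iterate_succ_apply']

/-- The pull-back of polynomials along the prolonged action. -/
def pullbackPoly (g : GroupElt) : JetPoly →ₐ[ℝ] JetRat := MvPolynomial.aeval g.pullbackCoord

theorem hasValueAt_pullbackPoly (g : GroupElt) {ψ : ℝ → ℝ} {t : ℝ}
    (hψ : ContDiffAt ℝ (⊤ : ℕ∞) ψ t) (hd : g.den (ψ t) ≠ 0) (p : JetPoly) :
    HasValueAt (g.pullbackPoly p) (jet ψ t)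
      (MvPolynomial.eval (jet (g.onFun ψ) (g.onBase t)) p) :=
  HasValueAt.aeval (g.hasValueAt_pullbackCoord hψ hd) p

theorem contDiffAt_onFun (g : GroupElt) {φ : ℝ → ℝ} (hφ : ContDiff ℝ (⊤ : ℕ∞) φ) {t : ℝ}
    (hd : g.den (φ t) ≠ 0) : ContDiffAt ℝ (⊤ : ℕ∞) (g.onFun φ) (g.onBase t) := by
  have h1 : ContDiff ℝ (⊤ : ℕ∞) g.inverse.onBase := by
    unfold onBase; fun_prop
  have h2 : ContDiff ℝ (⊤ : ℕ∞) fun s => φ (g.inverse.onBase s) := hφ.comp h1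
  rw [show g.onFun φ = _ from funext (g.onFun_eq φ)]
  refine contDiffAt_const.mul (ContDiffAt.div (by fun_prop) ?_ ?_)
  · unfold den; fun_prop
  · rwa [inverse_onBase_onBase]

theorem den_onFun_inverse (g : GroupElt) (φ : ℝ → ℝ) {r : ℝ} (hd : g.inverse.den (φ r) ≠ 0) :
    g.den (g.inverse.onFun φ (g.inverse.onBase r)) = (g.inverse.den (φ r))⁻¹ := by
  have h : g.inverse.inverse.onBase (g.inverse.onBase r) = r := inverse_onBase_onBase _ _
  rw [onFun_eq, h, sign_inverse]
  have h' : g.inverse.den (φ r) = -(g.sign * g.M 1 0) * φ r + g.M 0 0 := by simp [den, inverse]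
  have h00 : g.inverse.M 0 0 = g.M 1 1 := by simp [inverse]
  have h01 : g.inverse.M 0 1 = -(g.sign * g.M 0 1) := by simp [inverse]
  rw [h00, h01]
  rw [den]
  generalize g.inverse.den (φ r) = Δ at hd h' ⊢
  field_simp
  linear_combination g.det_eq - g.M 0 1 * g.M 1 0 * g.sign_mul_sign + g.M 1 1 * h'

theorem onFun_onFun_inverse (g : GroupElt) (φ : ℝ → ℝ) {r : ℝ} (hd : g.inverse.den (φ r) ≠ 0) :
    g.onFun (g.inverse.onFun φ) r = φ r := by
  have h : g.inverse.inverse.onBase (g.inverse.onBase r) = r := inverse_onBase_onBase _ _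
  rw [onFun_eq g, den_onFun_inverse g φ hd, onFun_eq g.inverse, h, sign_inverse]
  have h' : g.inverse.den (φ r) = -(g.sign * g.M 1 0) * φ r + g.M 0 0 := by simp [den, inverse]
  have h00 : g.inverse.M 0 0 = g.M 1 1 := by simp [inverse]
  have h01 : g.inverse.M 0 1 = -(g.sign * g.M 0 1) := by simp [inverse]
  rw [h00, h01]
  generalize g.inverse.den (φ r) = Δ at hd h' ⊢
  field_simp
  linear_combination φ r * g.sign ^ 2 * g.det_eq + g.sign * g.M 0 1 * h' +
    (φ r - g.sign * g.M 0 0 * g.M 0 1) * g.sign_mul_sign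

/-- A generic jet is the `g`-image of its `g.inverse`-image, so a polynomial with zero pull-back
vanishes at generic jets. -/
theorem pullbackPoly_injective (g : GroupElt) : Function.Injective g.pullbackPoly := by
  rw [injective_iff_map_eq_zero]
  intro p hp
  by_contra h0
  obtain ⟨φ, r, hφ, -, h⟩ :=
    exists_jet_isRegularAt [algebraMap JetPoly JetRat p, g.inverse.denRat]
  obtain ⟨y, hy, hy0⟩ := h _ List.mem_cons_self
  obtain ⟨z, hz, hz0⟩ := h g.inverse.denRat (by simp)
  have hd : ∀ s, g.inverse.den (jet φ s (some 0)) = g.inverse.den (φ s) := by simp [jet]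
  have hd0 : g.inverse.den (φ r) ≠ 0 := by
    rw [← hd, (g.inverse.hasValueAt_denRat _).unique hz]
    exact hz0 g.inverse.denRat_ne_zero
  have h1 := g.hasValueAt_pullbackPoly (g.inverse.contDiffAt_onFun hφ hd0)
    (by rw [den_onFun_inverse g φ hd0]; exact inv_ne_zero hd0) p
  have h2 : g.onFun (g.inverse.onFun φ) =ᶠ[𝓝 r] φ := by
    have hc : ContinuousAt (fun s => g.inverse.den (φ s)) r := by
      have := hφ.continuous
      unfold den
      fun_prop
    filter_upwards [hc.eventually_ne hd0] with s hs
    exact onFun_onFun_inverse g φ hs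
  have h3 : jet (g.onFun (g.inverse.onFun φ)) (g.onBase (g.inverse.onBase r)) = jet φ r := by
    rw [onBase_inverse_onBase]
    funext v
    rcases v with _ | i
    · rfl
    · exact h2.iteratedDeriv_eq i
  rw [h3, hp] at h1
  refine h1.ne_zero ?_ rfl
  rw [(HasValueAt.polynomial p _).unique hy]
  exact hy0 (algebraMap_ne_zero h0)

/-- The pull-back of rational functions along the prolonged action. -/
def pullback (g : GroupElt) : JetRat →ₐ[ℝ] JetRat :=
  IsFractionRing.liftAlgHom g.pullbackPoly_injective

theorem pullback_algebraMap (g : GroupElt) (p : JetPoly) :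
    g.pullback (algebraMap JetPoly JetRat p) = g.pullbackPoly p :=
  IsFractionRing.lift_algebraMap (g := g.pullbackPoly.toRingHom) g.pullbackPoly_injective p

theorem pullback_psi_zero (g : GroupElt) : g.pullback (psi 0) = algebraMap ℝ JetRat g.sign *
    ((algebraMap ℝ JetRat (g.M 0 0) * psi 0 + algebraMap ℝ JetRat (g.M 0 1)) / g.denRat) := by
  rw [psi, pullback_algebraMap, pullbackPoly, MvPolynomial.aeval_X]
  rfl

theorem pullback_psi_succ (g : GroupElt) (i : ℕ) : g.pullback (psi (i + 1)) =
    algebraMap ℝ JetRat g.rate⁻¹ * totalD (g.pullback (psi i)) := by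
  simp only [psi, pullback_algebraMap, pullbackPoly, MvPolynomial.aeval_X]
  simp only [pullbackCoord, Function.iterate_succ_apply']

end GroupElt

theorem totalD_tCoord : totalD tCoord = 1 := by
  rw [tCoord, totalD_algebraMap, totalDPoly, MvPolynomial.mkDerivation_X, map_one]

theorem totalD_psi (i : ℕ) : totalD (psi i) = psi (i + 1) := by
  rw [psi, totalD_algebraMap, totalDPoly, MvPolynomial.mkDerivation_X]; rfl

theorem totalD_const (c : ℝ) : totalD (algebraMap ℝ JetRat c) = 0 := totalD.map_algebraMap c

theorem totalD_mul (f h : JetRat) : totalD (f * h) = f * totalD h + h * totalD f :=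
  totalD.leibniz f h

namespace GroupElt

/-- Both sides are derivations along the homomorphism `g.pullback`, and they agree on `t` and, by
construction of `pullbackCoord`, on each `ψ_i`. -/
theorem pullback_totalD (g : GroupElt) (f : JetRat) :
    g.pullback (totalD f) = algebraMap ℝ JetRat g.rate⁻¹ * totalD (g.pullback f) := by
  have hX : ∀ v, g.pullback (totalD (algebraMap JetPoly JetRat (MvPolynomial.X v))) =
      algebraMap ℝ JetRat g.rate⁻¹ *
        totalD (g.pullback (algebraMap JetPoly JetRat (MvPolynomial.X v))) := by
    rintro (_ | i)
    · have h : g.pullback tCoord = algebraMap ℝ JetRat g.sign *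
          (algebraMap ℝ JetRat (Real.exp (2 * g.s₂)) * tCoord + algebraMap ℝ JetRat g.s₁) := by
        rw [tCoord, pullback_algebraMap, pullbackPoly, MvPolynomial.aeval_X]; rfl
      change g.pullback (totalD tCoord) = _ * totalD (g.pullback tCoord)
      rw [h]
      simp only [totalD_mul, map_add, totalD_const, totalD_tCoord, map_one, mul_zero, mul_one,
        add_zero]
      rw [← map_mul, ← map_mul, ← rate, inv_mul_cancel₀ g.rate_ne_zero, map_one]
    · change g.pullback (totalD (psi i)) = _ * totalD (g.pullback (psi i))
      rw [totalD_psi, pullback_psi_succ]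
  have hP : ∀ p : JetPoly, g.pullback (totalD (algebraMap JetPoly JetRat p)) =
      algebraMap ℝ JetRat g.rate⁻¹ * totalD (g.pullback (algebraMap JetPoly JetRat p)) := by
    intro p
    induction p using MvPolynomial.induction_on with
    | C c => rw [← algebraMap_real_eq, totalD_const, map_zero, AlgHom.commutes, totalD_const,
        mul_zero]
    | add p q hp hq => simp only [map_add, hp, hq, mul_add]
    | mul_X p v hp =>
      simp only [map_mul, totalD_mul, map_add, hp, hX]
      ring
  obtain ⟨p, q, hq, rfl⟩ := IsFractionRing.div_surjective (A := JetPoly) f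
  have hq := algebraMap_ne_zero (nonZeroDivisors.ne_zero hq)
  set f := algebraMap JetPoly JetRat p / algebraMap JetPoly JetRat q with hf
  have hfq : f * algebraMap JetPoly JetRat q = algebraMap JetPoly JetRat p :=
    div_mul_cancel₀ _ hq
  have h1 := hP p
  rw [← hfq] at h1
  simp only [totalD_mul, map_add, map_mul, hP q] at h1
  refine mul_left_cancel₀ ((map_ne_zero g.pullback).2 hq) ?_
  linear_combination h1

end GroupElt

/-! ### Agreement of the algebraic and the pointwise pull-back -/

theorem HasValueAt.pullback {f : JetRat} {g : GroupElt} {ψ : ℝ → ℝ} {t y : ℝ}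
    (hg : g.Acts ψ t) (h : HasValueAt f (jet (g.onFun ψ) (g.onBase t)) y) :
    HasValueAt (g.pullback f) (jet ψ t) y := by
  obtain ⟨p, q, hq, hf, rfl⟩ := h
  have hq0 : q ≠ 0 := by rintro rfl; simp at hq
  have hp' := g.hasValueAt_pullbackPoly hg.1 hg.2.2 p
  have hq' := g.hasValueAt_pullbackPoly hg.1 hg.2.2 q
  refine (hp'.div hq' hq).of_eq ?_ rfl
  rw [← g.pullback_algebraMap, ← g.pullback_algebraMap, ← hf, map_mul, mul_div_cancel_right₀]
  exact (map_ne_zero g.pullback).2 (algebraMap_ne_zero hq0)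

/-- If `f' - g.pullback f` were nonzero, it would be nonzero at some jet where `g` acts, `f'` is
defined and the pulled-back denominator of `f` does not vanish; there the pointwise condition forces
equality. -/
theorem isPullback_iff {g : GroupElt} {f f' : JetRat} : IsPullback g f f' ↔ f' = g.pullback f := by
  constructor
  · intro h
    obtain ⟨p, q, hq, hf⟩ := IsFractionRing.div_surjective (A := JetPoly) f
    have hq0 := algebraMap_ne_zero (nonZeroDivisors.ne_zero hq)
    obtain ⟨ψ, t, hψ, hψ', hl⟩ := exists_jet_isRegularAt
      [f' - g.pullback f, f', g.pullback (algebraMap JetPoly JetRat q), g.denRat]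
    obtain ⟨y, hy, hy0⟩ := hl (f' - g.pullback f) (by simp)
    obtain ⟨y', hy', -⟩ := hl f' (by simp)
    obtain ⟨z, hz, hz0⟩ := hl (g.pullback (algebraMap JetPoly JetRat q)) (by simp)
    obtain ⟨w, hw, hw0⟩ := hl g.denRat (by simp)
    have hd : g.den (ψ t) ≠ 0 := by
      have : g.den (ψ t) = w := by simpa [jet] using (g.hasValueAt_denRat _).unique hw
      rw [this]
      exact hw0 g.denRat_ne_zero
    have hg : g.Acts ψ t := ⟨hψ.contDiffAt, hψ', hd⟩
    have hqz := g.hasValueAt_pullbackPoly hg.1 hd q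
    rw [← g.pullback_algebraMap] at hqz
    have hq1 := hz0 ((map_ne_zero g.pullback).2 hq0)
    rw [hz.unique hqz] at hq1
    have hfx : HasValueAt f (jet (g.onFun ψ) (g.onBase t)) _ :=
      ⟨p, q, hq1, by rw [← hf, div_mul_cancel₀ _ hq0], rfl⟩
    have h1 := h ψ t hg _ _ hy' hfx
    have h2 := hy.unique (hy'.sub (hfx.pullback hg))
    rw [← h1, sub_self] at h2
    by_contra hne
    exact hy0 (sub_ne_zero.2 hne) h2
  · rintro rfl ψ t hg y y' hy' hy
    exact hy'.unique (hy.pullback hg)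

theorem isInvariant_iff {f : JetRat} : IsInvariant f ↔ ∀ g : GroupElt, g.pullback f = f := by
  simp only [IsInvariant, isPullback_iff, eq_comm]

/-! ### The Schwarzian derivative and its total derivatives -/

theorem totalD_div (f h : JetRat) : totalD (f / h) = (h * totalD f - f * totalD h) / h ^ 2 := by
  rw [Derivation.leibniz_div]
  simp only [smul_eq_mul]
  ring

theorem totalD_pow (f : JetRat) (n : ℕ) : totalD (f ^ n) = n * f ^ (n - 1) * totalD f := by
  rw [Derivation.leibniz_pow]
  simp only [smul_eq_mul, nsmul_eq_mul]
  ring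

theorem totalD_two : totalD 2 = 0 := totalD.map_natCast 2

theorem totalD_three : totalD 3 = 0 := totalD.map_natCast 3

theorem totalD_four : totalD 4 = 0 := totalD.map_natCast 4

theorem totalD_eight : totalD 8 = 0 := totalD.map_natCast 8

/-- The `n`-th total derivative of the Schwarzian derivative. -/
def schw (n : ℕ) : JetRat := totalD^[n] (psi 3 / psi 1 - 3 / 2 * (psi 2 / psi 1) ^ 2)

theorem totalD_schw (n : ℕ) : totalD (schw n) = schw (n + 1) := by
  simp only [schw, Function.iterate_succ_apply']

theorem psi_ne_zero (i : ℕ) : psi i ≠ 0 := (HasValueAt.psi i fun _ => 1).ne_zero one_ne_zero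

theorem schw_zero : schw 0 = (2 * psi 1 * psi 3 - 3 * psi 2 ^ 2) / (2 * psi 1 ^ 2) := by
  have := psi_ne_zero 1
  simp only [schw, Function.iterate_zero, id]
  field_simp

theorem schw_one : schw 1 =
    (psi 1 ^ 2 * psi 4 - 4 * psi 1 * psi 2 * psi 3 + 3 * psi 2 ^ 3) / psi 1 ^ 3 := by
  have := psi_ne_zero 1
  rw [← totalD_schw, schw_zero]
  simp only [totalD_div, map_sub, totalD_mul, totalD_pow, totalD_two, totalD_three, totalD_psi]
  field_simp
  push_cast
  ring

theorem schw_two : schw 2 =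
    (psi 1 ^ 3 * psi 5 - 5 * psi 1 ^ 2 * psi 2 * psi 4 - 4 * psi 1 ^ 2 * psi 3 ^ 2 +
      17 * psi 1 * psi 2 ^ 2 * psi 3 - 9 * psi 2 ^ 4) / psi 1 ^ 4 := by
  have := psi_ne_zero 1
  rw [← totalD_schw, schw_one]
  simp only [totalD_div, map_sub, map_add, totalD_mul, totalD_pow, totalD_three,
    totalD_four, totalD_psi]
  field_simp
  push_cast
  ring

/-- A jet at which the Schwarzian derivative and its total derivative do not vanish. -/
def sampleJet (v : Option ℕ) : ℝ := if v = some 2 then 0 else 1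

theorem HasValueAt.ofNat (n : ℕ) [n.AtLeastTwo] (x : Option ℕ → ℝ) :
    HasValueAt (OfNat.ofNat n) x (OfNat.ofNat n) :=
  (HasValueAt.const (OfNat.ofNat n) x).of_eq (map_ofNat _ n).symm rfl

theorem hasValueAt_invI_num (x : Option ℕ → ℝ) :
    HasValueAt (psi 1 ^ 2 * psi 4 - 4 * psi 1 * psi 2 * psi 3 + 3 * psi 2 ^ 3) x
      (x (some 1) ^ 2 * x (some 4) - 4 * x (some 1) * x (some 2) * x (some 3)
        + 3 * x (some 2) ^ 3) :=
  ((((HasValueAt.psi 1 x).pow 2).mul (HasValueAt.psi 4 x)).sub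
    ((((HasValueAt.ofNat 4 x).mul (HasValueAt.psi 1 x)).mul (HasValueAt.psi 2 x)).mul
      (HasValueAt.psi 3 x))).add ((HasValueAt.ofNat 3 x).mul ((HasValueAt.psi 2 x).pow 3))

theorem hasValueAt_invI_den (x : Option ℕ → ℝ) :
    HasValueAt (2 * psi 1 * psi 3 - 3 * psi 2 ^ 2) x
      (2 * x (some 1) * x (some 3) - 3 * x (some 2) ^ 2) :=
  (((HasValueAt.ofNat 2 x).mul (HasValueAt.psi 1 x)).mul (HasValueAt.psi 3 x)).sub
    ((HasValueAt.ofNat 3 x).mul ((HasValueAt.psi 2 x).pow 2))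

theorem invI_num_ne_zero : psi 1 ^ 2 * psi 4 - 4 * psi 1 * psi 2 * psi 3 + 3 * psi 2 ^ 3 ≠ 0 :=
  (hasValueAt_invI_num sampleJet).ne_zero (by simp [sampleJet])

theorem invI_den_ne_zero : 2 * psi 1 * psi 3 - 3 * psi 2 ^ 2 ≠ 0 :=
  (hasValueAt_invI_den sampleJet).ne_zero (by simp [sampleJet])

theorem schw_zero_ne_zero : schw 0 ≠ 0 := by
  have := psi_ne_zero 1
  rw [schw_zero]
  exact div_ne_zero invI_den_ne_zero (by simpa using this)

theorem schw_one_ne_zero : schw 1 ≠ 0 := by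
  rw [schw_one]
  exact div_ne_zero invI_num_ne_zero (pow_ne_zero 3 (psi_ne_zero 1))

theorem invI_eq : invI = schw 1 ^ 2 / (8 * schw 0 ^ 3) := by
  have h1 := psi_ne_zero 1
  have h2 := invI_den_ne_zero
  rw [invI, schw_zero, schw_one]
  generalize psi 1 ^ 2 * psi 4 - 4 * psi 1 * psi 2 * psi 3 + 3 * psi 2 ^ 3 = N
  generalize 2 * psi 1 * psi 3 - 3 * psi 2 ^ 2 = E at h2 ⊢
  field_simp
  norm_num

theorem invJ_eq : invJ = schw 2 / (4 * schw 0 ^ 2) + 1 := by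
  have h1 := psi_ne_zero 1
  have h2 := invI_den_ne_zero
  -- The numerators of `schw 2` and `invJ` differ by the square of `2 ψ₁ ψ₃ - 3 ψ₂²`, which is the
  -- origin of the summand `1`.
  have h3 : psi 1 ^ 3 * psi 5 - 5 * psi 1 ^ 2 * psi 2 * psi 4 - 4 * psi 1 ^ 2 * psi 3 ^ 2 +
      17 * psi 1 * psi 2 ^ 2 * psi 3 - 9 * psi 2 ^ 4 =
      psi 1 * (psi 1 ^ 2 * psi 5 - 5 * psi 1 * psi 2 * psi 4 + 5 * psi 2 ^ 2 * psi 3) -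
        (2 * psi 1 * psi 3 - 3 * psi 2 ^ 2) ^ 2 := by ring
  rw [invJ, schw_zero, schw_two, h3]
  generalize 2 * psi 1 * psi 3 - 3 * psi 2 ^ 2 = E at h2 ⊢
  field_simp
  ring

theorem totalD_invI : totalD invI = schw 1 / schw 0 * (invJ - 1 - 3 * invI) := by
  have h := schw_zero_ne_zero
  rw [invI_eq, invJ_eq]
  simp only [totalD_div, totalD_mul, totalD_pow, totalD_eight, totalD_schw]
  field_simp
  push_cast
  ring

/-! ### Behaviour of the Schwarzian derivative under the group -/

namespace GroupElt

theorem totalD_denRat (g : GroupElt) :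
    totalD g.denRat = algebraMap ℝ JetRat (g.M 1 0) * psi 1 := by
  simp only [denRat, map_add, totalD_mul, totalD_const, totalD_psi]
  ring

theorem pullback_psi_one (g : GroupElt) : g.pullback (psi 1) =
    algebraMap ℝ JetRat g.rate⁻¹ * (algebraMap ℝ JetRat g.sign * (psi 1 / g.denRat ^ 2)) := by
  have h := g.denRat_ne_zero
  have hdet := congrArg (algebraMap ℝ JetRat) g.det_eq
  simp only [map_sub, map_mul, map_one] at hdet
  rw [pullback_psi_succ, pullback_psi_zero]
  simp only [totalD_mul, totalD_div, map_add, totalD_const, totalD_psi, totalD_denRat, zero_add]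
  generalize algebraMap ℝ JetRat g.rate⁻¹ = r
  have hden : g.denRat = algebraMap ℝ JetRat (g.M 1 0) * psi 0 + algebraMap ℝ JetRat (g.M 1 1) :=
    rfl
  generalize g.denRat = Δ at h hden ⊢
  field_simp
  linear_combination r * algebraMap ℝ JetRat g.sign * psi 1 *
    (hdet + algebraMap ℝ JetRat (g.M 0 0) * hden)

theorem pullback_psi_two (g : GroupElt) : g.pullback (psi 2) =
    algebraMap ℝ JetRat g.rate⁻¹ ^ 2 * algebraMap ℝ JetRat g.sign * (psi 2 / g.denRat ^ 2 -
      2 * algebraMap ℝ JetRat (g.M 1 0) * psi 1 ^ 2 / g.denRat ^ 3) := by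
  have h := g.denRat_ne_zero
  rw [pullback_psi_succ, pullback_psi_one]
  simp only [totalD_mul, totalD_div, totalD_pow, totalD_const, totalD_psi, totalD_denRat]
  field_simp
  push_cast
  ring

theorem pullback_psi_three (g : GroupElt) : g.pullback (psi 3) =
    algebraMap ℝ JetRat g.rate⁻¹ ^ 3 * algebraMap ℝ JetRat g.sign * (psi 3 / g.denRat ^ 2 -
      6 * algebraMap ℝ JetRat (g.M 1 0) * psi 1 * psi 2 / g.denRat ^ 3 +
      6 * algebraMap ℝ JetRat (g.M 1 0) ^ 2 * psi 1 ^ 3 / g.denRat ^ 4) := by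
  have h := g.denRat_ne_zero
  rw [pullback_psi_succ, pullback_psi_two]
  simp only [totalD_mul, totalD_div, totalD_pow, map_sub, totalD_const, totalD_psi, totalD_denRat,
    totalD_two]
  field_simp
  push_cast
  ring

theorem algebraMap_rate_inv_ne_zero (g : GroupElt) : algebraMap ℝ JetRat g.rate⁻¹ ≠ 0 := by
  simpa using g.rate_ne_zero

theorem pullback_schw (g : GroupElt) (n : ℕ) :
    g.pullback (schw n) = algebraMap ℝ JetRat g.rate⁻¹ ^ (n + 2) * schw n := by
  induction n with
  | zero =>
    have h := g.denRat_ne_zero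
    have h1 := psi_ne_zero 1
    have hr := g.algebraMap_rate_inv_ne_zero
    have hs : algebraMap ℝ JetRat g.sign ≠ 0 := by simpa using g.sign_ne_zero
    simp only [schw_zero, map_div₀, map_sub, map_mul, map_pow, map_ofNat, pullback_psi_one,
      pullback_psi_two, pullback_psi_three]
    generalize algebraMap ℝ JetRat g.rate⁻¹ = r at hr ⊢
    field_simp
    ring
  | succ n ih =>
    rw [← totalD_schw, pullback_totalD, ih, totalD_mul, totalD_pow, totalD_const]
    ring

theorem pullback_invI (g : GroupElt) : g.pullback invI = invI := by
  have h := schw_zero_ne_zero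
  have hr := g.algebraMap_rate_inv_ne_zero
  simp only [invI_eq, map_div₀, map_mul, map_pow, map_ofNat, pullback_schw]
  generalize algebraMap ℝ JetRat g.rate⁻¹ = r at hr ⊢
  field_simp
  ring

theorem pullback_invJ (g : GroupElt) : g.pullback invJ = invJ := by
  have h := schw_zero_ne_zero
  have hr := g.algebraMap_rate_inv_ne_zero
  simp only [invJ_eq, map_add, map_one, map_div₀, map_mul, map_pow, map_ofNat, pullback_schw]
  generalize algebraMap ℝ JetRat g.rate⁻¹ = r at hr ⊢
  field_simp
  ring

/-- The scale factors of `D_t f` and `D_t I` cancel. -/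
theorem pullback_derI (g : GroupElt) (f : JetRat) : g.pullback (derI f) = derI (g.pullback f) := by
  have hr := g.algebraMap_rate_inv_ne_zero
  simp only [derI, Derivation.smul_apply, smul_eq_mul, map_mul, map_inv₀ g.pullback, pullback_totalD,
    pullback_invI]
  rw [mul_inv, mul_mul_mul_comm, inv_mul_cancel₀ hr, one_mul]

end GroupElt

/-! ### Invariance of the generated field -/

theorem isInvariantDerivation_derI : IsInvariantDerivation derI := by
  intro g f f' h
  rw [isPullback_iff] at h ⊢
  rw [h, g.pullback_derI]

/-- The field of rational differential invariants. -/
def invariantField : IntermediateField ℝ JetRat where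
  carrier := {f | ∀ g : GroupElt, g.pullback f = f}
  mul_mem' ha hb g := by rw [map_mul, ha g, hb g]
  add_mem' ha hb g := by rw [map_add, ha g, hb g]
  algebraMap_mem' c g := g.pullback.commutes c
  inv_mem' a ha g := by rw [map_inv₀, ha g]

theorem generatedField_le {L : IntermediateField ℝ JetRat} {S : Set JetRat}
    {δ : Derivation ℝ JetRat JetRat} (hS : S ⊆ L) (hδ : ∀ f ∈ L, δ f ∈ L) :
    generatedField S δ ≤ L :=
  sInf_le ⟨hS, hδ⟩

theorem subset_generatedField (S : Set JetRat) (δ : Derivation ℝ JetRat JetRat) :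
    S ⊆ generatedField S δ := by
  intro f hf
  rw [generatedField, SetLike.mem_coe, IntermediateField.mem_sInf]
  exact fun L hL => hL.1 hf

theorem apply_mem_generatedField {S : Set JetRat} {δ : Derivation ℝ JetRat JetRat} {f : JetRat}
    (hf : f ∈ generatedField S δ) : δ f ∈ generatedField S δ := by
  rw [generatedField, IntermediateField.mem_sInf] at hf ⊢
  exact fun L hL => hL.2 f (hf L hL)

theorem isInvariant_of_mem_generatedField {f : JetRat} (hf : f ∈ generatedField {invI, invJ} derI) :
    IsInvariant f := by
  refine isInvariant_iff.2 (generatedField_le (L := invariantField) ?_ ?_ hf)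
  · rintro f (rfl | rfl) g
    exacts [g.pullback_invI, g.pullback_invJ]
  · intro f hf g
    rw [g.pullback_derI, hf g]

/-! ### The orders of the invariants -/

/-- The translation `ψ_k ↦ ψ_k + c` on polynomials. -/
def shiftPoly (k : ℕ) (c : ℝ) : JetPoly →ₐ[ℝ] JetPoly :=
  MvPolynomial.aeval fun v =>
    MvPolynomial.X v + MvPolynomial.C (if v = some k then c else 0)

theorem shiftPoly_injective (k : ℕ) (c : ℝ) : Function.Injective (shiftPoly k c) := by
  have h : (shiftPoly k (-c)).comp (shiftPoly k c) = AlgHom.id ℝ JetPoly := by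
    refine MvPolynomial.algHom_ext fun v => ?_
    by_cases hv : v = some k <;> simp [shiftPoly, hv]
  exact Function.LeftInverse.injective (g := shiftPoly k (-c)) fun p => DFunLike.congr_fun h p

/-- The translation `ψ_k ↦ ψ_k + 1` on rational functions. -/
def shift (k : ℕ) : JetRat →ₐ[ℝ] JetRat :=
  IsFractionRing.liftAlgHom
    (g := (IsScalarTower.toAlgHom ℝ JetPoly JetRat).comp (shiftPoly k 1))
    ((IsFractionRing.injective JetPoly JetRat).comp (shiftPoly_injective k 1))

theorem shift_algebraMap (k : ℕ) (p : JetPoly) :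
    shift k (algebraMap JetPoly JetRat p) = algebraMap JetPoly JetRat (shiftPoly k 1 p) :=
  IsFractionRing.lift_algebraMap
    (g := ((IsScalarTower.toAlgHom ℝ JetPoly JetRat).comp (shiftPoly k 1)).toRingHom)
    ((IsFractionRing.injective JetPoly JetRat).comp (shiftPoly_injective k 1)) p

theorem shift_psi_self (k : ℕ) : shift k (psi k) = psi k + 1 := by
  simp [psi, shift_algebraMap, shiftPoly]

theorem shift_psi_of_ne {k i : ℕ} (h : i ≠ k) : shift k (psi i) = psi i := by
  simp [psi, shift_algebraMap, shiftPoly, h]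

theorem shift_tCoord (k : ℕ) : shift k tCoord = tCoord := by
  simp [tCoord, shift_algebraMap, shiftPoly]

/-- This is the test for the order: a function that changes under `ψ_k ↦ ψ_k + 1` lives on no jet
space below `J^k`. -/
theorem shift_eq_self {k j : ℕ} (hj : j < k) {f : JetRat} (hf : f ∈ jetField j) :
    shift k f = f := by
  induction hf using IntermediateField.adjoin_induction with
  | mem f hf =>
    rcases hf with rfl | ⟨i, hi, rfl⟩
    · exact shift_tCoord k
    · exact shift_psi_of_ne (by omega)
  | algebraMap c => exact (shift k).commutes c
  | add a b _ _ ha hb => rw [map_add, ha, hb]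
  | inv a _ ha => rw [map_inv₀, ha]
  | mul a b _ _ ha hb => rw [map_mul, ha, hb]

theorem psi_mem_jetField {i k : ℕ} (h : i ≤ k) : psi i ∈ jetField k :=
  IntermediateField.subset_adjoin _ _ (Or.inr ⟨i, h, rfl⟩)

theorem invI_mem {L : IntermediateField ℝ JetRat} (h : ∀ i, 1 ≤ i → i ≤ 4 → psi i ∈ L) :
    invI ∈ L := by
  have h1 := h 1 (by norm_num) (by norm_num)
  have h2 := h 2 (by norm_num) (by norm_num)
  have h3 := h 3 (by norm_num) (by norm_num)
  have h4 := h 4 (by norm_num) (by norm_num)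
  have n (k : ℕ) [k.AtLeastTwo] : (OfNat.ofNat k : JetRat) ∈ L := ofNat_mem L k
  refine div_mem (pow_mem (add_mem (sub_mem ?_ ?_) ?_) 2) (pow_mem (sub_mem ?_ ?_) 3)
  · exact mul_mem (pow_mem h1 2) h4
  · exact mul_mem (mul_mem (mul_mem (n 4) h1) h2) h3
  · exact mul_mem (n 3) (pow_mem h2 3)
  · exact mul_mem (mul_mem (n 2) h1) h3
  · exact mul_mem (n 3) (pow_mem h2 2)

theorem invJ_mem {L : IntermediateField ℝ JetRat} (h : ∀ i, 1 ≤ i → i ≤ 5 → psi i ∈ L) :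
    invJ ∈ L := by
  have h1 := h 1 (by norm_num) (by norm_num)
  have h2 := h 2 (by norm_num) (by norm_num)
  have h3 := h 3 (by norm_num) (by norm_num)
  have h4 := h 4 (by norm_num) (by norm_num)
  have h5 := h 5 (by norm_num) (by norm_num)
  have n (k : ℕ) [k.AtLeastTwo] : (OfNat.ofNat k : JetRat) ∈ L := ofNat_mem L k
  refine div_mem (mul_mem h1 (add_mem (sub_mem ?_ ?_) ?_)) (pow_mem (sub_mem ?_ ?_) 2)
  · exact mul_mem (pow_mem h1 2) h5
  · exact mul_mem (mul_mem (mul_mem (n 5) h1) h2) h4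
  · exact mul_mem (mul_mem (n 5) (pow_mem h2 2)) h3
  · exact mul_mem (mul_mem (n 2) h1) h3
  · exact mul_mem (n 3) (pow_mem h2 2)

theorem hasOrder_invI : HasOrder invI 4 := by
  refine ⟨invI_mem fun i _ hi => psi_mem_jetField hi, fun j hj hf => ?_⟩
  have h := shift_eq_self hj hf
  have hden := invI_den_ne_zero
  have h1 := psi_ne_zero 1
  simp only [invI, map_div₀, map_pow, map_add, map_sub, map_mul, map_ofNat, shift_psi_self,
    shift_psi_of_ne (show (1 : ℕ) ≠ 4 by norm_num), shift_psi_of_ne (show (2 : ℕ) ≠ 4 by norm_num),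
    shift_psi_of_ne (show (3 : ℕ) ≠ 4 by norm_num)] at h
  rw [div_left_inj' (pow_ne_zero 3 hden)] at h
  -- The shift adds `ψ₁²` to the numerator before squaring; this is the resulting difference of
  -- squares, with value `3` at `sampleJet`.
  have h' : psi 1 ^ 2 * (2 * (psi 1 ^ 2 * psi 4 - 4 * psi 1 * psi 2 * psi 3 + 3 * psi 2 ^ 3) +
      psi 1 ^ 2) = 0 := by linear_combination h
  refine HasValueAt.ne_zero (((HasValueAt.psi 1 sampleJet).pow 2).mul
    (((HasValueAt.ofNat 2 _).mul (hasValueAt_invI_num _)).add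
      ((HasValueAt.psi 1 sampleJet).pow 2))) ?_ h'
  norm_num [sampleJet]

theorem hasOrder_invJ : HasOrder invJ 5 := by
  refine ⟨invJ_mem fun i _ hi => psi_mem_jetField hi, fun j hj hf => ?_⟩
  have h := shift_eq_self hj hf
  have hden := invI_den_ne_zero
  have h1 := psi_ne_zero 1
  simp only [invJ, map_div₀, map_pow, map_add, map_sub, map_mul, map_ofNat, shift_psi_self,
    shift_psi_of_ne (show (1 : ℕ) ≠ 5 by norm_num), shift_psi_of_ne (show (2 : ℕ) ≠ 5 by norm_num),
    shift_psi_of_ne (show (3 : ℕ) ≠ 5 by norm_num),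
    shift_psi_of_ne (show (4 : ℕ) ≠ 5 by norm_num)] at h
  rw [div_left_inj' (pow_ne_zero 2 hden)] at h
  exact pow_ne_zero 3 h1 (by linear_combination h)

/-- Otherwise `J` would be a function of `I`, hence of order at most `4`. -/
theorem invJ_sub_ne_zero : invJ - 1 - 3 * invI ≠ 0 := by
  intro h
  have hI : invI ∈ jetField 4 := hasOrder_invI.1
  refine hasOrder_invJ.2 4 (by norm_num) ?_
  rw [show invJ = 1 + 3 * invI by linear_combination h]
  exact add_mem (one_mem _) (mul_mem (ofNat_mem _ 3) hI)

theorem totalD_invI_ne_zero : totalD invI ≠ 0 := by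
  rw [totalD_invI]
  exact mul_ne_zero (div_ne_zero schw_one_ne_zero schw_zero_ne_zero) invJ_sub_ne_zero

/-! ### The generated field -/

/-- The scale-invariant combinations of the derivatives of the Schwarzian derivative. -/
def normSchw (n : ℕ) : JetRat := schw n / (schw 1 / schw 0) ^ (n + 2)

theorem normSchw_mem (n : ℕ) : normSchw n ∈ generatedField {invI, invJ} derI := by
  have h0 := schw_zero_ne_zero
  have h1 := schw_one_ne_zero
  have hI : invI ∈ generatedField {invI, invJ} derI := subset_generatedField _ _ (by simp)
  have hJ : invJ ∈ generatedField {invI, invJ} derI := subset_generatedField _ _ (by simp)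
  induction n with
  | zero =>
    have : normSchw 0 = (8 * invI)⁻¹ := by
      rw [normSchw, invI_eq, zero_add, div_pow]
      field_simp
    rw [this]
    exact inv_mem (mul_mem (ofNat_mem _ 8) hI)
  | succ n ih =>
    -- With `m = S_1 / S_0`, differentiating `S_n / m ^ (n + 2)` and dividing by `m` gives `normSchw
    -- (n + 1) - (n + 2) * normSchw n * (D_t m / m²)`. Here `D_t m / m² = (J - 1) / (2 I) - 1`, and
    -- `D_t / m = (J - 1 - 3 I) * derI` by `totalD_invI`.
    have h : normSchw (n + 1) = (invJ - 1 - 3 * invI) * derI (normSchw n) +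
        (n + 2) * normSchw n * ((invJ - 1) / (2 * invI) - 1) := by
      have h2 := invJ_sub_ne_zero
      have hm0 := div_ne_zero h1 h0
      have h3 : (invJ - 1 - 3 * invI) * derI (normSchw n) =
          totalD (normSchw n) / (schw 1 / schw 0) := by
        rw [derI, Derivation.smul_apply, smul_eq_mul, totalD_invI]
        field_simp
      have h4 : (invJ - 1) / (2 * invI) = schw 2 / (schw 0 * (schw 1 / schw 0) ^ 2) := by
        rw [invI_eq, invJ_eq]
        field_simp
        ring
      have hD : totalD (schw 1 / schw 0) = schw 2 / schw 0 - (schw 1 / schw 0) ^ 2 := by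
        rw [totalD_div, totalD_schw, totalD_schw]
        field_simp
      rw [h3, h4, normSchw, normSchw]
      generalize schw 1 / schw 0 = m at hm0 hD ⊢
      rw [totalD_div, totalD_pow, hD, totalD_schw, Nat.add_sub_assoc one_le_two]
      field_simp
      push_cast
      ring
    rw [h]
    have h2 : (n + 2 : JetRat) ∈ generatedField {invI, invJ} derI :=
      add_mem (natCast_mem _ n) (ofNat_mem _ 2)
    refine add_mem (mul_mem ?_ (apply_mem_generatedField ih)) (mul_mem (mul_mem h2 ih) ?_)
    · exact sub_mem (sub_mem hJ (one_mem _)) (mul_mem (ofNat_mem _ 3) hI)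
    · exact sub_mem (div_mem (sub_mem hJ (one_mem _)) (mul_mem (ofNat_mem _ 2) hI)) (one_mem _)

theorem psi_mem_fibreField {i : ℕ} (h : 1 ≤ i) : psi i ∈ fibreField :=
  IntermediateField.subset_adjoin _ _ ⟨i, h, rfl⟩

theorem totalD_mem_fibreField {f : JetRat} (hf : f ∈ fibreField) : totalD f ∈ fibreField := by
  induction hf using IntermediateField.adjoin_induction with
  | mem f hf =>
    obtain ⟨i, hi, rfl⟩ := hf
    rw [totalD_psi]
    exact psi_mem_fibreField (by omega)
  | algebraMap c => rw [totalD_const]; exact zero_mem _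
  | add a b _ _ ha hb => rw [map_add]; exact add_mem ha hb
  | inv a ha' ha =>
    rw [Derivation.leibniz_inv, smul_eq_mul]
    exact mul_mem (neg_mem (pow_mem (inv_mem ha') 2)) ha
  | mul a b ha' hb' ha hb =>
    rw [totalD_mul]
    exact add_mem (mul_mem ha' hb) (mul_mem hb' ha)

theorem schw_mem_fibreField (n : ℕ) : schw n ∈ fibreField := by
  induction n with
  | zero =>
    have h1 := psi_mem_fibreField (i := 1) (by norm_num)
    have h2 := psi_mem_fibreField (i := 2) (by norm_num)
    have h3 := psi_mem_fibreField (i := 3) (by norm_num)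
    rw [schw_zero]
    exact div_mem (sub_mem (mul_mem (mul_mem (ofNat_mem _ 2) h1) h3)
      (mul_mem (ofNat_mem _ 3) (pow_mem h2 2))) (mul_mem (ofNat_mem _ 2) (pow_mem h1 2))
  | succ n ih =>
    rw [← totalD_schw]
    exact totalD_mem_fibreField ih

theorem generatedField_le_fibreField : generatedField {invI, invJ} derI ≤ fibreField := by
  have hI : invI ∈ fibreField := invI_mem fun i hi _ => psi_mem_fibreField hi
  refine generatedField_le ?_ fun f hf => ?_
  · rintro f (rfl | rfl)
    exacts [hI, invJ_mem fun i hi _ => psi_mem_fibreField hi]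
  · rw [derI, Derivation.smul_apply, smul_eq_mul]
    exact mul_mem (inv_mem (totalD_mem_fibreField hI)) (totalD_mem_fibreField hf)

/-! ### Moving jets to a cross-section of the group action -/

/-- Generators of the algebra of rational functions of the jets with `ψ₁` inverted, in terms of
the total derivatives of the Schwarzian derivative. -/
def schwGens : Option ℕ → JetRat
  | none => (psi 1)⁻¹
  | some 0 => psi 0
  | some 1 => psi 1
  | some 2 => psi 2
  | some (j + 3) => schw j

theorem schwGens_mem_range (v : Option ℕ) :
    schwGens v ∈ (MvPolynomial.aeval schwGens : JetPoly →ₐ[ℝ] JetRat).range :=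
  ⟨MvPolynomial.X v, MvPolynomial.aeval_X _ _⟩

theorem psi_three_eq :
    psi 3 = psi 1 * schw 0 + algebraMap ℝ JetRat (3 / 2) * psi 2 ^ 2 * (psi 1)⁻¹ := by
  have := psi_ne_zero 1
  rw [schw_zero, map_div₀, map_ofNat, map_ofNat]
  field_simp
  ring

/-- Only `D_t ψ₂ = ψ₃` is not visibly a polynomial in the generators; solving the Schwarzian for
`ψ₃` handles it. All `ψ_i = D_t^i ψ₀` then lie in this algebra. -/
theorem totalD_mem_range_schwGens {f : JetRat}
    (hf : f ∈ (MvPolynomial.aeval schwGens : JetPoly →ₐ[ℝ] JetRat).range) :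
    totalD f ∈ (MvPolynomial.aeval schwGens : JetPoly →ₐ[ℝ] JetRat).range := by
  have h0 := schwGens_mem_range none
  have h1 := schwGens_mem_range (some 1)
  have h2 := schwGens_mem_range (some 2)
  obtain ⟨p, rfl⟩ := hf
  induction p using MvPolynomial.induction_on with
  | C c =>
    have : totalD (MvPolynomial.aeval schwGens (MvPolynomial.C c)) = 0 := by
      rw [MvPolynomial.aeval_C, totalD_const]
    change totalD (MvPolynomial.aeval schwGens (MvPolynomial.C c)) ∈ _
    rw [this]
    exact zero_mem _
  | add p q hp hq =>
    change totalD (MvPolynomial.aeval schwGens (p + q)) ∈ _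
    rw [map_add, map_add]
    exact add_mem hp hq
  | mul_X p v hp =>
    change totalD (MvPolynomial.aeval schwGens (p * MvPolynomial.X v)) ∈ _
    rw [map_mul, totalD_mul, MvPolynomial.aeval_X]
    refine add_mem (mul_mem ⟨p, rfl⟩ ?_) (mul_mem (schwGens_mem_range v) hp)
    match v with
    | none =>
      change totalD (psi 1)⁻¹ ∈ _
      rw [Derivation.leibniz_inv, smul_eq_mul, totalD_psi]
      exact mul_mem (neg_mem (pow_mem h0 2)) h2
    | some 0 =>
      change totalD (psi 0) ∈ _
      rw [totalD_psi]
      exact h1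
    | some 1 =>
      change totalD (psi 1) ∈ _
      rw [totalD_psi]
      exact h2
    | some 2 =>
      change totalD (psi 2) ∈ _
      rw [totalD_psi, psi_three_eq]
      exact add_mem (mul_mem h1 (schwGens_mem_range (some 3)))
        (mul_mem (mul_mem (Subalgebra.algebraMap_mem _ _) (pow_mem h2 2)) h0)
    | some (j + 3) =>
      change totalD (schw j) ∈ _
      rw [totalD_schw]
      exact schwGens_mem_range (some (j + 1 + 3))

theorem exists_aeval_schwGens (i : ℕ) :
    ∃ p : JetPoly, MvPolynomial.aeval schwGens p = psi i := by
  change psi i ∈ (MvPolynomial.aeval schwGens : JetPoly →ₐ[ℝ] JetRat).range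
  induction i with
  | zero => exact schwGens_mem_range (some 0)
  | succ i ih =>
    rw [← totalD_psi]
    exact totalD_mem_range_schwGens ih

/-- A polynomial expressing `ψ_i` through `schwGens`. -/
def schwPoly (i : ℕ) : JetPoly := (exists_aeval_schwGens i).choose

/-- The values of `schwGens` at the jet `x`, when `schw j` has the value `s j`. -/
def schwVals (x : Option ℕ → ℝ) (s : ℕ → ℝ) : Option ℕ → ℝ
  | none => (x (some 1))⁻¹
  | some 0 => x (some 0)
  | some 1 => x (some 1)
  | some 2 => x (some 2)
  | some (j + 3) => s j

theorem eval_schwPoly {x : Option ℕ → ℝ} {s : ℕ → ℝ} (hx : x (some 1) ≠ 0)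
    (hs : ∀ j, HasValueAt (schw j) x (s j)) (i : ℕ) :
    MvPolynomial.eval (schwVals x s) (schwPoly i) = x (some i) := by
  have h : ∀ v, HasValueAt (schwGens v) x (schwVals x s v) := by
    intro v
    match v with
    | none => exact (HasValueAt.psi 1 x).inv hx
    | some 0 => exact HasValueAt.psi 0 x
    | some 1 => exact HasValueAt.psi 1 x
    | some 2 => exact HasValueAt.psi 2 x
    | some (j + 3) => exact hs j
  refine (HasValueAt.aeval h (schwPoly i)).unique ?_
  rw [schwPoly, (exists_aeval_schwGens i).choose_spec]
  exact HasValueAt.psi i x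

theorem exists_hasValueAt_schw {ψ : ℝ → ℝ} {t : ℝ} (hψ : ContDiffAt ℝ (⊤ : ℕ∞) ψ t)
    (h : jet ψ t (some 1) ≠ 0) (j : ℕ) : ∃ y, HasValueAt (schw j) (jet ψ t) y := by
  induction j with
  | zero =>
    rw [schw_zero]
    exact ⟨_, (hasValueAt_invI_den _).div ((HasValueAt.ofNat 2 _).mul ((HasValueAt.psi 1 _).pow 2))
      (mul_ne_zero two_ne_zero (pow_ne_zero 2 h))⟩
  | succ j ih =>
    obtain ⟨y, hy⟩ := ih
    rw [← totalD_schw]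
    exact hy.exists_totalD hψ

/-- The functions which agree with `schwGens` on the cross-section through `x` with `schw 1 / schw 0`
equal to `m`, and are constant on the orbits. -/
def sectionGens (x : Option ℕ → ℝ) (m : ℝ) : Option ℕ → JetRat
  | none => algebraMap ℝ JetRat (x (some 1))⁻¹
  | some 0 => algebraMap ℝ JetRat (x (some 0))
  | some 1 => algebraMap ℝ JetRat (x (some 1))
  | some 2 => algebraMap ℝ JetRat (x (some 2))
  | some (j + 3) => algebraMap ℝ JetRat (m ^ (j + 2)) * normSchw j

/-- The coordinates of the representative of an orbit on the cross-section. -/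
def sectionCoord (x : Option ℕ → ℝ) (m : ℝ) : Option ℕ → JetRat
  | none => algebraMap ℝ JetRat (x none)
  | some i => MvPolynomial.aeval (sectionGens x m) (schwPoly i)

theorem aeval_mem {σ : Type*} {L : IntermediateField ℝ JetRat} {θ : σ → JetRat}
    (h : ∀ v, θ v ∈ L) (p : MvPolynomial σ ℝ) : MvPolynomial.aeval θ p ∈ L := by
  induction p using MvPolynomial.induction_on with
  | C c => rw [MvPolynomial.aeval_C]; exact L.algebraMap_mem c
  | add p q hp hq => rw [map_add]; exact add_mem hp hq
  | mul_X p i hp => rw [map_mul, MvPolynomial.aeval_X]; exact mul_mem hp (h i)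

theorem sectionCoord_mem (x : Option ℕ → ℝ) (m : ℝ) (v : Option ℕ) :
    sectionCoord x m v ∈ generatedField {invI, invJ} derI := by
  match v with
  | none => exact IntermediateField.algebraMap_mem _ _
  | some i =>
    refine aeval_mem (fun v => ?_) _
    match v with
    | none => exact IntermediateField.algebraMap_mem _ _
    | some 0 => exact IntermediateField.algebraMap_mem _ _
    | some 1 => exact IntermediateField.algebraMap_mem _ _
    | some 2 => exact IntermediateField.algebraMap_mem _ _
    | some (j + 3) => exact mul_mem (IntermediateField.algebraMap_mem _ _) (normSchw_mem j)

/-- Here `x'` is the moved jet. Since `r = m / (s 1 / s 0)`, its value `r ^ (j + 2) * s j` of `schw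
j` is `m ^ (j + 2)` times the value of `normSchw j` at `x`. -/
theorem hasValueAt_sectionCoord {x₀ x x' : Option ℕ → ℝ} {m r : ℝ} {s : ℕ → ℝ}
    (hx₀ : x₀ (some 1) ≠ 0) (h : x' none = x₀ none)
    (h0 : x' (some 0) = x₀ (some 0)) (h1 : x' (some 1) = x₀ (some 1))
    (h2 : x' (some 2) = x₀ (some 2)) (hs : ∀ j, HasValueAt (schw j) x (s j))
    (hs' : ∀ j, HasValueAt (schw j) x' (r ^ (j + 2) * s j)) (hs0 : s 0 ≠ 0) (hs1 : s 1 ≠ 0)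
    (hr : r * (s 1 / s 0) = m) (v : Option ℕ) : HasValueAt (sectionCoord x₀ m v) x (x' v) := by
  match v with
  | none => exact (HasValueAt.const _ _).of_eq rfl h
  | some i =>
    rw [← eval_schwPoly (h1.trans_ne hx₀) hs' i]
    refine HasValueAt.aeval (fun v => ?_) _
    match v with
    | none => exact (HasValueAt.const _ _).of_eq rfl (congrArg _ h1)
    | some 0 => exact (HasValueAt.const _ _).of_eq rfl h0
    | some 1 => exact (HasValueAt.const _ _).of_eq rfl h1
    | some 2 => exact (HasValueAt.const _ _).of_eq rfl h2
    | some (j + 3) =>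
      refine ((HasValueAt.const _ _).mul ((hs j).div (((hs 1).div (hs 0) hs0).pow (j + 2))
        (pow_ne_zero _ (div_ne_zero hs1 hs0)))).of_eq rfl ?_
      change r ^ (j + 2) * s j = _
      rw [← hr, mul_pow]
      have := pow_ne_zero (j + 2) (div_ne_zero hs1 hs0)
      field_simp

/-- The group element with prescribed value, first two derivatives and scale. -/
theorem exists_groupElt {ψ : ℝ → ℝ} {t : ℝ} (hψ : ContDiffAt ℝ (⊤ : ℕ∞) ψ t)
    (hψ' : 0 < deriv ψ t) (t₀ u₀ c₂ : ℝ) {c₁ r : ℝ} (hc : 0 < c₁) (hr : r ≠ 0) :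
    ∃ g : GroupElt, g.Acts ψ t ∧ g.rate⁻¹ = r ∧ g.onBase t = t₀ ∧
      g.onFun ψ (g.onBase t) = u₀ ∧ jet (g.onFun ψ) (g.onBase t) (some 1) = c₁ ∧
      jet (g.onFun ψ) (g.onBase t) (some 2) = c₂ := by
  -- The factor `ℤ₂` supplies the sign of `r`, the affine scaling its absolute value.
  obtain ⟨ε, e, he, hee, her⟩ : ∃ (ε : ℤˣ) (e : ℝ), ((ε : ℤ) : ℝ) = e ∧ e * e = 1 ∧ r = e * |r| := by
    rcases lt_or_gt_of_ne hr with h | h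
    · exact ⟨-1, -1, by simp, by simp, by rw [abs_of_neg h]; ring⟩
    · exact ⟨1, 1, by simp, by simp, by rw [abs_of_pos h]; ring⟩
  have he0 : e ≠ 0 := by rintro rfl; simp at hee
  set R := |r|
  have hR : 0 < R := abs_pos.2 hr
  set x₁ := deriv ψ t with hx₁
  set x₂ := iteratedDeriv 2 ψ t
  -- `Δ` is to be the denominator at `ψ t`: the new first derivative is `R * x₁ / Δ ^ 2`, which must
  -- equal `c₁`.
  set Δ := √(R * x₁ / c₁) with hΔ
  have hΔ0 : Δ ≠ 0 := (Real.sqrt_pos.2 (by positivity)).ne'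
  have hΔ2 : Δ ^ 2 = R * x₁ / c₁ := Real.sq_sqrt (by positivity)
  -- Solves `r ^ 2 * e * (x₂ / Δ ^ 2 - 2 * c * x₁ ^ 2 / Δ ^ 3) = c₂`, the condition on the second
  -- derivative.
  set c := (x₂ / Δ ^ 2 - c₂ * e / r ^ 2) * Δ ^ 3 / (2 * x₁ ^ 2) with hcdef
  -- Forced by determinant one, once the other entries give denominator `Δ` and image value `u₀`.
  set a := 1 / Δ + e * u₀ * c with ha
  set g : GroupElt :=
    { s₁ := e * t₀ - R⁻¹ * t
      s₂ := Real.log R⁻¹ / 2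
      M := ⟨!![a, e * u₀ * Δ - a * ψ t; c, Δ - c * ψ t], by
        rw [Matrix.det_fin_two_of, ha]; field_simp; ring⟩
      ε := ε } with hg
  have hsign : g.sign = e := he
  have hexp : Real.exp (2 * g.s₂) = R⁻¹ := by
    rw [show 2 * g.s₂ = Real.log R⁻¹ by simp only [hg]; ring, Real.exp_log (by positivity)]
  have h10 : g.M 1 0 = c := by simp [hg]
  have h11 : g.M 1 1 = Δ - c * ψ t := by simp [hg]
  have h00 : g.M 0 0 = a := by simp [hg]
  have h01 : g.M 0 1 = e * u₀ * Δ - a * ψ t := by simp [hg]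
  have hden : g.den (ψ t) = Δ := by rw [GroupElt.den, h10, h11]; ring
  have hrate : g.rate⁻¹ = r := by
    rw [GroupElt.rate, hsign, hexp, mul_inv, inv_inv, her]
    congr 1
    field_simp
    linear_combination -hee
  have hacts : g.Acts ψ t := ⟨hψ, hψ', by rwa [hden]⟩
  have hval := g.hasValueAt_denRat (jet ψ t)
  rw [show jet ψ t (some 0) = ψ t by simp [jet], hden] at hval
  have hpsi : ∀ i, HasValueAt (g.pullback (psi i)) (jet ψ t)
      (jet (g.onFun ψ) (g.onBase t) (some i)) := by
    intro i
    have := g.hasValueAt_pullbackPoly hacts.1 hacts.2.2 (MvPolynomial.X (some i))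
    rwa [← g.pullback_algebraMap, MvPolynomial.eval_X] at this
  have hj1 : jet ψ t (some 1) = x₁ := by simp [jet, hx₁]
  have hj2 : jet ψ t (some 2) = x₂ := rfl
  refine ⟨g, hacts, hrate, ?_, ?_, ?_, ?_⟩
  · rw [GroupElt.onBase, hsign, hexp]
    simp only [hg]
    linear_combination t₀ * hee
  · rw [GroupElt.onFun_eq, GroupElt.inverse_onBase_onBase, hden, hsign, h00, h01]
    field_simp
    linear_combination Δ * u₀ * hee
  · have h1 := hpsi 1
    rw [g.pullback_psi_one] at h1
    have h2 := (HasValueAt.const g.rate⁻¹ (jet ψ t)).mul ((HasValueAt.const g.sign _).mul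
      ((HasValueAt.psi 1 _).div (hval.pow 2) (pow_ne_zero 2 hΔ0)))
    rw [h1.unique h2, hrate, hsign, hj1, hΔ2, her]
    field_simp
    linear_combination hee
  · have h1 := hpsi 2
    rw [g.pullback_psi_two] at h1
    have h2 := (((HasValueAt.const g.rate⁻¹ (jet ψ t)).pow 2).mul (HasValueAt.const g.sign _)).mul
      (((HasValueAt.psi 2 _).div (hval.pow 2) (pow_ne_zero 2 hΔ0)).sub
        ((((HasValueAt.ofNat 2 _).mul (HasValueAt.const (g.M 1 0) _)).mul
          ((HasValueAt.psi 1 _).pow 2)).div (hval.pow 3) (pow_ne_zero 3 hΔ0)))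
    rw [h1.unique h2, hrate, hsign, hj1, hj2, h10, hcdef]
    have hx0 : x₁ ≠ 0 := hψ'.ne'
    field_simp
    linear_combination Δ ^ 2 * c₂ * hee

/-- A rational function is equal on the orbits of generic jets over a point of `J⁰` to an element
of the generated field. -/
theorem exists_mem_generatedField {f : JetRat} {φ : ℝ → ℝ} {t₀ : ℝ}
    (hφ : ContDiff ℝ (⊤ : ℕ∞) φ) (hφ' : 0 < deriv φ t₀)
    (hf : IsRegularAt f (jet φ t₀)) (h0 : IsRegularAt (schw 0) (jet φ t₀))
    (h1 : IsRegularAt (schw 1) (jet φ t₀)) :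
    ∃ h ∈ generatedField {invI, invJ} derI, ∃ w ∈ generatedField {invI, invJ} derI, w ≠ 0 ∧
      ∀ (ψ : ℝ → ℝ) (t : ℝ), ContDiff ℝ (⊤ : ℕ∞) ψ → 0 < deriv ψ t →
        IsRegularAt (schw 0) (jet ψ t) → IsRegularAt (schw 1) (jet ψ t) →
        IsRegularAt w (jet ψ t) →
        ∃ (g : GroupElt) (y : ℝ), g.Acts ψ t ∧ g.onBase t = t₀ ∧
          g.onFun ψ (g.onBase t) = φ t₀ ∧
          HasValueAt f (jet (g.onFun ψ) (g.onBase t)) y ∧ HasValueAt h (jet ψ t) y := by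
  have hj1 : ∀ (ψ : ℝ → ℝ) (t : ℝ), jet ψ t (some 1) = deriv ψ t := fun ψ t => by simp [jet]
  have hnz : ∀ {k x y}, schw k ≠ 0 → IsRegularAt (schw k) x → HasValueAt (schw k) x y → y ≠ 0 := by
    rintro k x y hk ⟨z, hz, hz0⟩ hy
    rw [hy.unique hz]
    exact hz0 hk
  have hx₀ : jet φ t₀ (some 1) ≠ 0 := by rw [hj1]; exact hφ'.ne'
  obtain ⟨-, ⟨p, q, hq, hpq, -⟩, -⟩ := hf
  choose s₀ hs₀ using exists_hasValueAt_schw hφ.contDiffAt hx₀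
  have hs00 := hnz schw_zero_ne_zero h0 (hs₀ 0)
  have hs01 := hnz schw_one_ne_zero h1 (hs₀ 1)
  set m := s₀ 1 / s₀ 0
  have hm : m ≠ 0 := div_ne_zero hs01 hs00
  have hmem := sectionCoord_mem (jet φ t₀) m
  -- The jet of `φ` lies on the cross-section itself, so with `r = 1` the value there is that of
  -- `q`, which is nonzero.
  have hw : MvPolynomial.aeval (sectionCoord (jet φ t₀) m) q ≠ 0 := by
    refine (HasValueAt.aeval (fun v => hasValueAt_sectionCoord (r := 1) hx₀ rfl rfl rfl rfl hs₀
      (fun j => ?_) hs00 hs01 (one_mul _) v) q).ne_zero hq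
    simpa using hs₀ j
  refine ⟨MvPolynomial.aeval (sectionCoord (jet φ t₀) m) p /
    MvPolynomial.aeval (sectionCoord (jet φ t₀) m) q, div_mem (aeval_mem hmem p) (aeval_mem hmem q),
    MvPolynomial.aeval (sectionCoord (jet φ t₀) m) q, aeval_mem hmem q, hw, ?_⟩
  intro ψ t hψ hψ' hr0 hr1 ⟨z, hz, hz0⟩
  choose s hs using exists_hasValueAt_schw hψ.contDiffAt (by rw [hj1]; exact hψ'.ne')
  have hs0 := hnz schw_zero_ne_zero hr0 (hs 0)
  have hs1 := hnz schw_one_ne_zero hr1 (hs 1)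
  have hr : m / (s 1 / s 0) ≠ 0 := div_ne_zero hm (div_ne_zero hs1 hs0)
  obtain ⟨g, hg, hrate, hgt, hg0, hg1, hg2⟩ := exists_groupElt hψ.contDiffAt hψ' t₀ (φ t₀)
    (jet φ t₀ (some 2)) hφ' hr
  rw [← hj1 φ] at hg1
  -- The value of `schw j` at the moved jet is that of its pull-back at the original jet, known from
  -- `pullback_schw`.
  have hs' : ∀ j, HasValueAt (schw j) (jet (g.onFun ψ) (g.onBase t))
      ((m / (s 1 / s 0)) ^ (j + 2) * s j) := by
    intro j
    obtain ⟨y, hy⟩ := exists_hasValueAt_schw (g.contDiffAt_onFun hψ hg.2.2) (hg1.trans_ne hx₀) j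
    have h2 := hy.pullback hg
    rw [g.pullback_schw, hrate] at h2
    rwa [h2.unique (((HasValueAt.const _ _).pow _).mul (hs j))] at hy
  have hval := fun v => hasValueAt_sectionCoord hx₀ hgt (by simpa [jet] using hg0) hg1 hg2 hs hs'
    hs0 hs1 (div_mul_cancel₀ m (div_ne_zero hs1 hs0)) v
  have hp' := HasValueAt.aeval hval p
  have hq' := HasValueAt.aeval hval q
  have hq0 := hz0 hw
  rw [hz.unique hq'] at hq0
  exact ⟨g, _, hg, hgt, hg0, ⟨p, q, hq0, hpq, rfl⟩, hp'.div hq' hq0⟩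

/-! ### Comparison of invariants with elements of the generated field -/

theorem eq_of_isRegularAt_sub {f h : JetRat} {x : Option ℕ → ℝ} {y : ℝ}
    (hr : IsRegularAt (f - h) x) (hf : HasValueAt f x y) (hh : HasValueAt h x y) : f = h := by
  obtain ⟨z, hz, hz0⟩ := hr
  by_contra hne
  refine hz0 (sub_ne_zero.2 hne) ?_
  rw [hz.unique (hf.sub hh), sub_self]

theorem mem_generatedField_of_isInvariant {f : JetRat} (hf : IsInvariant f) :
    f ∈ generatedField {invI, invJ} derI := by
  obtain ⟨φ, t₀, hφ, hφ', hl⟩ := exists_jet_isRegularAt [f, schw 0, schw 1]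
  obtain ⟨h, hh, w, -, -, H⟩ := exists_mem_generatedField hφ hφ' (hl f (by simp))
    (hl (schw 0) (by simp)) (hl (schw 1) (by simp))
  obtain ⟨ψ, t, hψ, hψ', hl'⟩ := exists_jet_isRegularAt [f - h, f, schw 0, schw 1, w]
  obtain ⟨g, y, hg, -, -, hy, hy'⟩ := H ψ t hψ hψ' (hl' (schw 0) (by simp))
    (hl' (schw 1) (by simp)) (hl' w (by simp))
  obtain ⟨z, hz, -⟩ := hl' f (by simp)
  rw [hf g ψ t hg y z hz hy] at hz
  rwa [eq_of_isRegularAt_sub (hl' (f - h) (by simp)) hz hy']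

/-- The element `h` comes from one jet over `(t₀, u₀)`. For each `(t, u)` in `U` a single generic
jet over it is moved over `(t₀, u₀)`, so no regularity in `(t, u)` enters. Such a jet exists over
every point because all functions involved lie in `fibreField`. -/
theorem IsFibrewiseInvariantOn.exists_mem_generatedField {U : Set (ℝ × ℝ)} {F : ℝ → ℝ → JetRat}
    (hU : U.Nonempty) (hF : IsFibrewiseInvariantOn U F) :
    ∃ f ∈ generatedField {invI, invJ} derI, ∀ t u, (t, u) ∈ U → F t u = f := by
  obtain ⟨⟨t₀, u₀⟩, hU₀⟩ := hU
  have hs0 := schw_mem_fibreField 0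
  have hs1 := schw_mem_fibreField 1
  obtain ⟨φ, hφ, hφ0, hφ', hl⟩ := exists_jet_isRegularAt_of_mem_fibreField
    [F t₀ u₀, schw 0, schw 1] (by simp [hF.1, hs0, hs1]) t₀ u₀
  obtain ⟨h, hh, w, hw, -, H⟩ := WeylJets.exists_mem_generatedField hφ hφ'
    (hl (F t₀ u₀) (by simp)) (hl (schw 0) (by simp)) (hl (schw 1) (by simp))
  refine ⟨h, hh, fun t u htu => ?_⟩
  have hh' := generatedField_le_fibreField hh
  have hw' := generatedField_le_fibreField hw
  obtain ⟨ψ, hψ, hψ0, hψ', hl'⟩ := exists_jet_isRegularAt_of_mem_fibreField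
    [F t u - h, F t u, schw 0, schw 1, w]
    (by simp [hF.1, hs0, hs1, hw', sub_mem (hF.1 t u) hh']) t u
  obtain ⟨g, y, hg, hgt, hg0, hy, hy'⟩ := H ψ t hψ hψ' (hl' (schw 0) (by simp))
    (hl' (schw 1) (by simp)) (hl' w (by simp))
  obtain ⟨z, hz, -⟩ := hl' (F t u) (by simp)
  have hF' : F (g.onBase t) (g.onFun ψ (g.onBase t)) = F t₀ u₀ := by rw [hg0, hgt, hφ0]
  have key := hF.2 g ψ t hg (by rwa [hψ0]) (by rwa [hg0, hgt, hφ0]) y z (by rwa [hψ0])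
    (by rwa [hF'])
  rw [key] at hz
  exact eq_of_isRegularAt_sub (hl' (F t u - h) (by simp)) hz hy'

end WeylJets

end

open WeylJets in
theorem proposition5p1 :
    -- the functions have the stated orders
    HasOrder invI 4 ∧ HasOrder invJ 5 ∧
    -- the derivation is well defined and invariant
    totalD invI ≠ 0 ∧ IsInvariantDerivation derI ∧
    -- the rational differential invariants are the elements of the generated field
    {f : JetRat | IsInvariant f} = (generatedField {invI, invJ} derI : Set JetRat) ∧
    -- invariants that are rational only on the fibres over `J⁰` give nothing more
    ∀ (U : Set (ℝ × ℝ)) (F : ℝ → ℝ → JetRat), IsOpen U → U.Nonempty →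
      IsFibrewiseInvariantOn U F →
      ∃ f ∈ generatedField {invI, invJ} derI, ∀ t u, (t, u) ∈ U → F t u = f :=
  ⟨hasOrder_invI, hasOrder_invJ, totalD_invI_ne_zero, isInvariantDerivation_derI,
    Set.ext fun _ => ⟨mem_generatedField_of_isInvariant, isInvariant_of_mem_generatedField⟩,
    fun _ _ _ hU hF => hF.exists_mem_generatedField hU⟩
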